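/- For integers $p\ge 1$, $n\ge 2$ let $B(s,t)=\Gamma(s)\Gamma(t)/\Gamma(s+t)$ and $$c_{p,n}=\Big(\tfrac{n-1}{2}B\big(\tfrac12,\tfrac{n-1}{2}\big)\sqrt{1-p^{-2/(n-1)}}\Big)^{2/(n-1)},\quad a_{p,n}=1-p^{-2/(n-1)}c_{p,n},\quad b_{p,n}=\tfrac{2}{n-1}\,p^{-2/(n-1)}c_{p,n},$$ $$G_n(x)=\begin{cases}\exp\!\big(-(1-\tfrac{2x}{n-1})^{(n-1)/2}\big), & x\le \tfrac{n-1}{2},\\ 1, & x>\tfrac{n-1}{2}.\end{cases}$$ 1. (Maximal independent inner product.) For each $p$ and each $n\ge 2$ let $L_1,\dots,L_p$ be i.i.d. uniformly distributed on the unit sphere $S^{n-1}\subset\mathbb R^n$, let $U$ be a random unit vector of $\mathbb R^n$, of arbitrary law, independent of $(L_1,\dots,L_p)$, and let $M_{p,n}=\max_{1\le j\le p}|\langle L_j,U\rangle|$. Then for every fixed real $x$, as $p\to\infty$, $$\sup_{n\ge 2}\Big|P\Big(\frac{M_{p,n}^2-a_{p,n}}{b_{p,n}}<x\Big)-G_n(x)\Big|\to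 0,$$ and, as $n\to\infty$ and $p\to\infty$ (double limit), $P\big((M_{p,n}^2-a_{p,n})/b_{p,n}<x\big)\to\exp(-e^{-x})$. 2. (Maximal spurious correlation.) For each $p$ and each $n\ge 3$ let $n$ i.i.d. samples be observed of independent nondegenerate Gaussian variables $X_1,\dots,X_p$ (with arbitrary means and variances) and of a random variable $Y$, of arbitrary law, independent of $(X_1,\dots,X_p)$. Let $\hat C(X_j,Y)=\frac{\sum_i (X_{ij}-\bar X_j)(Y_i-\bar Y)}{\sqrt{\sum_i (X_{ij}-\bar X_j)^2}\sqrt{\sum_i(Y_i-\bar Y)^2}}$ be the sample correlation (read as $0$ where it is undefined), let $M_{XY}=\max_{1\le j\le p}|\hat C(X_j,Y)|$, and let $D=D_{p,n}$ be the event that the observations $Y_1,\dots,Y_n$ are not all equal, so that $\hat C(X_j,Y)$ is almost surely defined on $D$. Assume $P(D)>0$, i.e. that $Y$ is not almost surely constant. Then for every fixed real $x$: (a) as $p\to\infty$, $\ \sup_{n\ge 3}\Big|P\Big(\frac{M_{XY}^2-a_{p,n-1}}{b_{p,n-1}}<x\,\Big|\,D\Big)-G_{n-1}(x)\Big|\to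 0$; (b) as $n\to\infty$ and $p\to\infty$ (double limit), $P\big((M_{XY}^2-a_{p,n-1})/b_{p,n-1}<x\,\big|\,D\big)\to\exp(-e^{-x})$; (c) if $P(D_{p,n})=1$ for all $p$ and all $n\ge3$ (i.e. if the law of $Y$ has no atoms), then (a) holds for the unconditional probability $P$; (d) if $P(D_{p,n})\to 1$ as $n,p\to\infty$ (in particular if the law of $Y$ is a fixed nondegenerate one), then (b) holds for the unconditional probability $P$. -/

import Mathlib

open MeasureTheory ProbabilityTheory Filter Topology

universe u

noncomputable section

/-- The correction factor
`c_{p,n} = ((n-1)/2 * B(1/2, (n-1)/2) * sqrt (1 - p^{-2/(n-1)}))^{2/(n-1)}`. -/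
def cConst (p n : ℕ) : ℝ :=
  (((n : ℝ) - 1) / 2 * beta (1 / 2) (((n : ℝ) - 1) / 2) *
    Real.sqrt (1 - (p : ℝ) ^ (-2 / ((n : ℝ) - 1)))) ^ (2 / ((n : ℝ) - 1))

/-- The centering constant `a_{p,n} = 1 - p^{-2/(n-1)} c_{p,n}`. -/
def aConst (p n : ℕ) : ℝ :=
  1 - (p : ℝ) ^ (-2 / ((n : ℝ) - 1)) * cConst p n

/-- The scaling constant `b_{p,n} = 2/(n-1) * p^{-2/(n-1)} c_{p,n}`. -/
def bConst (p n : ℕ) : ℝ :=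
  2 / ((n : ℝ) - 1) * (p : ℝ) ^ (-2 / ((n : ℝ) - 1)) * cConst p n

/-- The limiting distribution function in dimension `n`:
`exp (-(1 - 2x/(n-1))^{(n-1)/2})` for `x ≤ (n-1)/2`, and `1` for `x > (n-1)/2`. -/
def limitDF (n : ℕ) (x : ℝ) : ℝ :=
  if x ≤ ((n : ℝ) - 1) / 2 then
    Real.exp (-(1 - 2 / ((n : ℝ) - 1) * x) ^ (((n : ℝ) - 1) / 2))
  else 1

/-- The uniform distribution on the unit sphere of `ℝⁿ` (normalized surface measure), as a
measure on `ℝⁿ`. -/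
def uniformSphere (n : ℕ) : Measure (EuclideanSpace ℝ (Fin n)) :=
  (((volume : Measure (EuclideanSpace ℝ (Fin n))).toSphere Set.univ)⁻¹ •
    (volume : Measure (EuclideanSpace ℝ (Fin n))).toSphere).map Subtype.val

/-- `L₁, …, L_p` are i.i.d. uniform on the unit sphere of `ℝⁿ`, and `U` is a random unit vector
(of arbitrary law) independent of `(L₁, …, L_p)`. -/
structure IsSphereSample {Ω : Type u} [MeasurableSpace Ω] {p n : ℕ}
    (L : Fin p → Ω → EuclideanSpace ℝ (Fin n)) (U : Ω → EuclideanSpace ℝ (Fin n))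
    (μ : Measure Ω) : Prop where
  law_L : ∀ j, HasLaw (L j) (uniformSphere n) μ
  indep_L : iIndepFun L μ
  aemeasurable_U : AEMeasurable U μ
  norm_U : ∀ᵐ ω ∂μ, ‖U ω‖ = 1
  indep_L_U : IndepFun (fun ω j => L j ω) U μ

/-- The maximal absolute inner product `M_{p,n} = max_j |⟨L_j, U⟩|`. -/
def maxInner {Ω : Type u} {p n : ℕ} (L : Fin p → Ω → EuclideanSpace ℝ (Fin n))
    (U : Ω → EuclideanSpace ℝ (Fin n)) (ω : Ω) : ℝ :=
  ⨆ j : Fin p, |inner ℝ (L j ω) (U ω)|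

/-- The sample mean. -/
def sampleMean {n : ℕ} (u : Fin n → ℝ) : ℝ := (∑ i, u i) / n

/-- Pearson's sample correlation coefficient (`0` if one of the samples is constant, in which
case the coefficient is undefined). -/
def sampleCorr {n : ℕ} (u v : Fin n → ℝ) : ℝ :=
  (∑ i, (u i - sampleMean u) * (v i - sampleMean v)) /
    (Real.sqrt (∑ i, (u i - sampleMean u) ^ 2) * Real.sqrt (∑ i, (v i - sampleMean v) ^ 2))

/-- `n` i.i.d. observations `(X i 1, …, X i p, Y i)` of independent (nondegenerate) Gaussian
variables `X₁, …, X_p` and of a variable `Y` of arbitrary law independent of the `X_j`. -/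
structure IsGaussianSample {Ω : Type u} [MeasurableSpace Ω] {p n : ℕ}
    (X : Fin n → Fin p → Ω → ℝ) (Y : Fin n → Ω → ℝ) (μ : Measure Ω) : Prop where
  law_X : ∀ j, ∃ (m : ℝ) (v : NNReal), v ≠ 0 ∧ ∀ i, HasLaw (X i j) (gaussianReal m v) μ
  indep_X : iIndepFun (fun ij : Fin n × Fin p => X ij.1 ij.2) μ
  identDistrib_Y : ∀ i i', IdentDistrib (Y i) (Y i') μ μ
  indep_Y : iIndepFun Y μ
  indep_X_Y : IndepFun (fun ω (ij : Fin n × Fin p) => X ij.1 ij.2 ω) (fun ω i => Y i ω) μ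

/-- The maximal absolute sample correlation `M_{XY} = max_j |Ĉ(X_j, Y)|`. -/
def maxCorr {Ω : Type u} {p n : ℕ} (X : Fin n → Fin p → Ω → ℝ) (Y : Fin n → Ω → ℝ)
    (ω : Ω) : ℝ :=
  ⨆ j : Fin p, |sampleCorr (fun i => X i j ω) (fun i => Y i ω)|

/-- The event that the observations of `Y` are not all equal, so that the sample correlations
with `Y` are defined. -/
def nonconst {Ω : Type u} {n : ℕ} (Y : Fin n → Ω → ℝ) : Set Ω :=
  {ω | ∃ i i', Y i ω ≠ Y i' ω}

end

/-!
The square of the cosine of the angle between a uniform direction (equivalently, a standard Gaussian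
vector) of a `d`-dimensional Euclidean space and a fixed direction has the Beta distribution with
parameters `1/2` and `(d-1)/2`. Centering a sample is projecting it onto the orthogonal complement
of the constants, where `d = n - 1`, so squared sample correlations with a Gaussian sample follow
this law as well. Conditionally on `U` (resp. on a nonconstant `Y`) the maximum is therefore a
maximum of `p` i.i.d. Beta variables, with distribution function `F ^ p`. Comparing the Beta density
with the derivative of `u ^ ((d-1)/2) (1-u) ^ (-1/2)`, `u` being the distance to `1`, gives a
two-sided bound on `1 - F`, and log-convexity of `Γ` bounds `c_{p,n}` between `exp (-2/(n-1))` and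
`(2 √(2 log p)) ^ (2/(n-1))`; together they give `p (1 - F) → (1 - 2x/(n-1))₊ ^ ((n-1)/2)`
uniformly in `n`.
-/

lemma lintegral_eq_ofReal_mul_lintegral_comp_mul_left {f : ℝ → ENNReal} (hf : Measurable f)
    {s : ℝ} (hs : 0 < s) : ∫⁻ x, f x = ENNReal.ofReal s * ∫⁻ u, f (s * u) := by
  rw [← lintegral_map hf (measurable_const_mul s), ← smul_eq_mul, ← lintegral_smul_measure,
    ← congrArg ENNReal.ofReal (abs_of_pos hs), Real.smul_map_volume_mul_left hs.ne']

@[fun_prop]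
lemma measurable_gammaPDF (a r : ℝ) : Measurable (gammaPDF a r) :=
  (measurable_gammaPDFReal a r).ennreal_ofReal

@[fun_prop]
lemma measurable_betaPDF (a b : ℝ) : Measurable (betaPDF a b) :=
  (measurable_betaPDFReal a b).ennreal_ofReal

lemma ofReal_mul_gammaPDF_mul_gammaPDF {a b r s u : ℝ} (ha : 0 < a) (hb : 0 < b) (hr : 0 < r)
    (hs : 0 < s) (hu0 : u ≠ 0) (hu1 : u ≠ 1) :
    ENNReal.ofReal s * (gammaPDF a r (s * u) * gammaPDF b r (s - s * u))
      = gammaPDF (a + b) r s * betaPDF a b u := by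
  rw [show s - s * u = s * (1 - u) by ring]
  rcases hu0.lt_or_gt with hu0 | hu0
  · rw [gammaPDF_of_neg (mul_neg_of_pos_of_neg hs hu0), betaPDF_eq_zero_of_nonpos hu0.le]
    simp
  rcases hu1.lt_or_gt with hu1 | hu1
  · have hu1' : 0 < 1 - u := sub_pos.2 hu1
    have := Real.Gamma_pos_of_pos ha
    have := Real.Gamma_pos_of_pos hb
    have := Real.Gamma_pos_of_pos (add_pos ha hb)
    rw [gammaPDF_of_nonneg (by positivity), gammaPDF_of_nonneg (by positivity),
      gammaPDF_of_nonneg hs.le, betaPDF_of_pos_lt_one hu0 hu1,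
      ← ENNReal.ofReal_mul (by positivity), ← ENNReal.ofReal_mul hs.le,
      ← ENNReal.ofReal_mul (by positivity), Real.mul_rpow hs.le hu0.le,
      Real.mul_rpow hs.le hu1'.le, Real.rpow_add hr, beta]
    have hexp : Real.exp (-(r * (s * u))) * Real.exp (-(r * (s * (1 - u))))
        = Real.exp (-(r * s)) := by
      rw [← Real.exp_add]
      ring_nf
    have hpow : s * (s ^ (a - 1) * s ^ (b - 1)) = s ^ (a + b - 1) := by
      rw [← Real.rpow_add hs]
      nth_rewrite 1 [← Real.rpow_one s]
      rw [← Real.rpow_add hs]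
      ring_nf
    rw [← hexp, ← hpow]
    congr 1
    field_simp
  · rw [gammaPDF_of_neg (mul_neg_of_pos_of_neg hs (sub_neg.2 hu1)),
      betaPDF_eq_zero_of_one_le hu1.le]
    simp

lemma lintegral_gammaPDF_mul_gammaPDF {a b r s : ℝ} (ha : 0 < a) (hb : 0 < b) (hr : 0 < r)
    (hs : s ≠ 0) {f : ℝ → ENNReal} (hf : Measurable f) :
    ∫⁻ x, gammaPDF a r x * gammaPDF b r (s - x) * f (x / s)
      = gammaPDF (a + b) r s * ∫⁻ u, betaPDF a b u * f u := by
  rcases hs.lt_or_gt with hs | hs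
  · rw [gammaPDF_of_neg hs, zero_mul]
    refine lintegral_eq_zero_of_ae_eq_zero (ae_of_all _ fun x => ?_)
    rcases lt_or_ge x 0 with hx | hx
    · simp [gammaPDF_of_neg hx]
    · simp [gammaPDF_of_neg (show s - x < 0 by linarith)]
  · rw [lintegral_eq_ofReal_mul_lintegral_comp_mul_left (by fun_prop) hs,
      ← lintegral_const_mul _ (by fun_prop), ← lintegral_const_mul _ (by fun_prop)]
    refine lintegral_congr_ae ?_
    filter_upwards [volume.ae_ne 0, volume.ae_ne 1] with u hu0 hu1
    rw [mul_div_cancel_left₀ u hs.ne', ← mul_assoc, ← mul_assoc (gammaPDF (a + b) r s),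
      ofReal_mul_gammaPDF_mul_gammaPDF ha hb hr hs hu0 hu1]

lemma map_add_div_gammaMeasure_prod {a b r : ℝ} (ha : 0 < a) (hb : 0 < b) (hr : 0 < r) :
    ((gammaMeasure a r).prod (gammaMeasure b r)).map (fun x => (x.1 + x.2, x.1 / (x.1 + x.2)))
      = (gammaMeasure (a + b) r).prod (betaMeasure a b) := by
  refine Measure.ext_of_lintegral _ fun f hf => ?_
  rw [lintegral_map hf (by fun_prop), gammaMeasure, gammaMeasure, gammaMeasure, betaMeasure,
    prod_withDensity (by fun_prop) (by fun_prop), prod_withDensity (by fun_prop) (by fun_prop),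
    lintegral_withDensity_eq_lintegral_mul _ (by fun_prop) (by fun_prop),
    lintegral_withDensity_eq_lintegral_mul _ (by fun_prop) hf,
    lintegral_prod _ (by fun_prop), lintegral_prod _ (by fun_prop)]
  simp only [Pi.mul_apply]
  calc ∫⁻ x, ∫⁻ y, gammaPDF a r x * gammaPDF b r y * f (x + y, x / (x + y))
      = ∫⁻ x, ∫⁻ s, gammaPDF a r x * gammaPDF b r (s - x) * f (s, x / s) := by
        refine lintegral_congr fun x => ?_
        rw [← lintegral_sub_right_eq_self _ x]
        simp only [add_sub_cancel]
    _ = ∫⁻ s, ∫⁻ x, gammaPDF a r x * gammaPDF b r (s - x) * f (s, x / s) :=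
        lintegral_lintegral_swap (by fun_prop)
    _ = ∫⁻ s, ∫⁻ u, gammaPDF (a + b) r s * betaPDF a b u * f (s, u) := by
        refine lintegral_congr_ae ?_
        filter_upwards [volume.ae_ne 0] with s hs
        simp only [mul_assoc]
        rw [lintegral_const_mul _ (by fun_prop)]
        simp only [← mul_assoc]
        exact lintegral_gammaPDF_mul_gammaPDF ha hb hr hs (hf.comp measurable_prodMk_left)

lemma map_add_gammaMeasure_prod {a b r : ℝ} (ha : 0 < a) (hb : 0 < b) (hr : 0 < r) :
    ((gammaMeasure a r).prod (gammaMeasure b r)).map (fun x => x.1 + x.2)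
      = gammaMeasure (a + b) r := by
  have := isProbabilityMeasureBeta ha hb
  have h := congrArg Measure.fst (map_add_div_gammaMeasure_prod ha hb hr)
  rwa [Measure.fst_prod, Measure.fst_map_prodMk (by fun_prop)] at h

lemma map_div_add_gammaMeasure_prod {a b r : ℝ} (ha : 0 < a) (hb : 0 < b) (hr : 0 < r) :
    ((gammaMeasure a r).prod (gammaMeasure b r)).map (fun x => x.1 / (x.1 + x.2))
      = betaMeasure a b := by
  have := isProbabilityMeasure_gammaMeasure (add_pos ha hb) hr
  have := isProbabilityMeasureBeta ha hb
  have h := congrArg Measure.snd (map_add_div_gammaMeasure_prod ha hb hr)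
  rwa [Measure.snd_prod, Measure.snd_map_prodMk (by fun_prop)] at h

lemma lintegral_eq_two_mul_setLIntegral_Ioi_of_even {f : ℝ → ENNReal} (hf : f.Even) :
    ∫⁻ x, f x = 2 * ∫⁻ x in Set.Ioi 0, f x := by
  have hneg : ∫⁻ x in Set.Iic 0, f x = ∫⁻ x in Set.Ioi 0, f x := by
    rw [setLIntegral_congr Iio_ae_eq_Iic.symm, ← lintegral_indicator measurableSet_Iio,
      ← lintegral_indicator measurableSet_Ioi, ← lintegral_neg_eq_self]
    refine lintegral_congr fun x => ?_
    simp [Set.indicator, hf x]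
  rw [← lintegral_add_compl f measurableSet_Ioi, Set.compl_Ioi, hneg, two_mul]

lemma two_mul_gaussianPDF {x : ℝ} (hx : 0 < x) :
    2 * gaussianPDF 0 1 x = ENNReal.ofReal (2 * x) * gammaPDF (1 / 2) (1 / 2) (x ^ 2) := by
  have hpow : (x ^ 2) ^ (1 / 2 - 1 : ℝ) = x⁻¹ := by
    rw [← Real.rpow_natCast_mul hx.le]
    norm_num [Real.rpow_neg_one]
  rw [gammaPDF_of_nonneg (sq_nonneg x), gaussianPDF, gaussianPDFReal, hpow,
    Real.Gamma_one_half_eq, ← Real.sqrt_eq_rpow, ← ENNReal.ofReal_mul (by positivity),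
    ← ENNReal.ofReal_ofNat 2, ← ENNReal.ofReal_mul zero_le_two, Real.sqrt_mul (by positivity),
    Real.sqrt_mul zero_le_two, Real.sqrt_div zero_le_one]
  congr 1
  simp only [NNReal.coe_one, Real.sqrt_one, sub_zero, mul_one]
  field_simp

lemma map_sq_gaussianReal :
    (gaussianReal 0 1).map (fun x => x ^ 2) = gammaMeasure (1 / 2) (1 / 2) := by
  refine Measure.ext_of_lintegral _ fun f hf => ?_
  have hφ : Measurable (gaussianPDF 0 1) := measurable_gaussianPDF 0 1
  have hsq : (fun x : ℝ => x ^ 2) '' Set.Ioi 0 = Set.Ioi 0 := by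
    refine Set.Subset.antisymm (Set.image_subset_iff.2 fun x (hx : 0 < x) => pow_pos hx 2)
      fun y hy => ?_
    exact ⟨√y, Real.sqrt_pos.2 hy, Real.sq_sqrt (le_of_lt hy)⟩
  rw [lintegral_map hf (by fun_prop), gaussianReal_of_var_ne_zero 0 one_ne_zero, gammaMeasure,
    lintegral_withDensity_eq_lintegral_mul _ hφ (by fun_prop),
    lintegral_withDensity_eq_lintegral_mul _ (by fun_prop) hf]
  calc ∫⁻ x, gaussianPDF 0 1 x * f (x ^ 2)
      = ∫⁻ x in Set.Ioi 0, 2 * (gaussianPDF 0 1 x * f (x ^ 2)) := by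
        rw [lintegral_const_mul _ (by fun_prop)]
        refine lintegral_eq_two_mul_setLIntegral_Ioi_of_even fun x => ?_
        simp [gaussianPDF, gaussianPDFReal]
    _ = ∫⁻ x in Set.Ioi 0, ENNReal.ofReal (2 * x) *
          (gammaPDF (1 / 2) (1 / 2) (x ^ 2) * f (x ^ 2)) := by
        refine setLIntegral_congr_fun measurableSet_Ioi fun x hx => ?_
        simp only [← mul_assoc, two_mul_gaussianPDF hx]
    _ = ∫⁻ y in Set.Ioi 0, gammaPDF (1 / 2) (1 / 2) y * f y := by
        rw [← lintegral_image_eq_lintegral_deriv_mul_of_monotoneOn (f := fun x => x ^ 2)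
          measurableSet_Ioi (fun x _ => by simpa using (hasDerivAt_pow 2 x).hasDerivWithinAt)
          (fun x hx y _ hxy => pow_le_pow_left₀ (le_of_lt hx) hxy 2)
          fun y => gammaPDF (1 / 2) (1 / 2) y * f y, hsq]
    _ = ∫⁻ y, gammaPDF (1 / 2) (1 / 2) y * f y := by
        rw [setLIntegral_congr Ioi_ae_eq_Ici, ← lintegral_indicator measurableSet_Ici,
          Set.indicator_eq_self.2]
        refine Function.support_subset_iff'.2 fun y hy => ?_
        rw [gammaPDF_of_neg (not_le.1 hy), zero_mul]

lemma map_sq_zero_sum_sq_succ_pi_gaussianReal (m : ℕ) :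
    (Measure.pi fun _ : Fin (m + 1) => gaussianReal 0 1).map
        (fun x => (x 0 ^ 2, ∑ i : Fin m, x i.succ ^ 2))
      = (gammaMeasure (1 / 2) (1 / 2)).prod
        ((Measure.pi fun _ : Fin m => gaussianReal 0 1).map fun x => ∑ i, x i ^ 2) := by
  rw [← map_sq_gaussianReal, Measure.map_prod_map _ _ (by fun_prop) (by fun_prop),
    ← (measurePreserving_piFinSuccAbove (fun _ : Fin (m + 1) => gaussianReal 0 1) 0).map_eq,
    Measure.map_map (by fun_prop) (by fun_prop)]
  rfl

lemma map_sum_sq_pi_gaussianReal {m : ℕ} (hm : m ≠ 0) :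
    (Measure.pi fun _ : Fin m => gaussianReal 0 1).map (fun x => ∑ i, x i ^ 2)
      = gammaMeasure (m / 2) (1 / 2) := by
  induction m, Nat.one_le_iff_ne_zero.2 hm using Nat.le_induction with
  | base =>
    have heval := (measurePreserving_eval (fun _ : Fin 1 => gaussianReal 0 1) 0).map_eq
    rw [Nat.cast_one, ← map_sq_gaussianReal]
    nth_rewrite 2 [← heval]
    rw [Measure.map_map (by fun_prop) (by fun_prop)]
    simp [Function.comp_def]
  | succ m hm ih =>
    have hm0 : (0 : ℝ) < m := by positivity
    have hadd := map_add_gammaMeasure_prod (a := 1 / 2) (b := (m : ℝ) / 2) (r := 1 / 2)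
      one_half_pos (half_pos hm0) one_half_pos
    rw [← ih (by omega), ← map_sq_zero_sum_sq_succ_pi_gaussianReal,
      Measure.map_map (by fun_prop) (by fun_prop)] at hadd
    rw [show ((m + 1 : ℕ) : ℝ) / 2 = 1 / 2 + m / 2 by push_cast; ring, ← hadd]
    simp only [Fin.sum_univ_succ]
    rfl

lemma exists_orthonormalBasis_zero_eq {E : Type*} [NormedAddCommGroup E] [InnerProductSpace ℝ E]
    [FiniteDimensional ℝ E] {m : ℕ} (hE : Module.finrank ℝ E = m + 1) {v : E} (hv : ‖v‖ = 1) :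
    ∃ b : OrthonormalBasis (Fin (m + 1)) ℝ E, b 0 = v := by
  obtain ⟨b, hb⟩ := Orthonormal.exists_orthonormalBasis_extension_of_card_eq (𝕜 := ℝ)
    (ι := Fin (m + 1)) (by simpa using hE) (v := fun _ => v) (s := {0})
    (orthonormal_subsingleton_iff.2 fun _ => hv)
  exact ⟨b, hb 0 rfl⟩

lemma cos_angle_sq_sum_smul {E : Type*} [NormedAddCommGroup E] [InnerProductSpace ℝ E] {m : ℕ}
    (b : OrthonormalBasis (Fin (m + 1)) ℝ E) (x : Fin (m + 1) → ℝ) :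
    Real.cos (InnerProductGeometry.angle (∑ i, x i • b i) (b 0)) ^ 2
      = x 0 ^ 2 / (x 0 ^ 2 + ∑ i : Fin m, x i.succ ^ 2) := by
  have hcoord : ∀ j, inner ℝ (b j) (∑ i, x i • b i) = x j := fun j => by
    simp [inner_sum, inner_smul_right, b.inner_eq_ite]
  rw [InnerProductGeometry.cos_angle, b.norm_eq_one, mul_one, div_pow, real_inner_comm, hcoord,
    ← b.sum_sq_norm_inner_right, Fin.sum_univ_succ]
  simp only [hcoord, Real.norm_eq_abs, sq_abs]

section StdGaussian

variable {E : Type*} [NormedAddCommGroup E] [InnerProductSpace ℝ E] [FiniteDimensional ℝ E]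
  [MeasurableSpace E] [BorelSpace E]

@[fun_prop]
lemma measurable_angle : Measurable fun z : E × E => InnerProductGeometry.angle z.1 z.2 := by
  unfold InnerProductGeometry.angle
  fun_prop

lemma map_cos_sq_angle_stdGaussian {m : ℕ} (hm : m ≠ 0) (hE : Module.finrank ℝ E = m + 1) {v : E}
    (hv : v ≠ 0) :
    (stdGaussian E).map (fun z => Real.cos (InnerProductGeometry.angle z v) ^ 2)
      = betaMeasure (1 / 2) (m / 2) := by
  obtain ⟨b, hb⟩ := exists_orthonormalBasis_zero_eq hE (norm_smul_inv_norm (𝕜 := ℝ) hv)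
  have hm0 : (0 : ℝ) < m := by positivity
  have hangle : ∀ z, InnerProductGeometry.angle z v = InnerProductGeometry.angle z (b 0) := by
    intro z
    rw [hb]
    exact (InnerProductGeometry.angle_smul_right_of_pos _ _
      (inv_pos.2 (norm_pos_iff.2 hv))).symm
  have hdiv := map_div_add_gammaMeasure_prod (a := 1 / 2) (b := (m : ℝ) / 2) (r := 1 / 2)
    one_half_pos (half_pos hm0) one_half_pos
  rw [← map_sum_sq_pi_gaussianReal hm, ← map_sq_zero_sum_sq_succ_pi_gaussianReal,
    Measure.map_map (by fun_prop) (by fun_prop)] at hdiv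
  rw [← hdiv, stdGaussian_eq_map_pi_orthonormalBasis b, Measure.map_map (by fun_prop) (by fun_prop)]
  congr 1
  ext x
  simp only [Function.comp_apply, hangle, cos_angle_sq_sum_smul]

lemma map_orthogonalProjectionOnto_stdGaussian (W : Submodule ℝ E) :
    (stdGaussian E).map W.orthogonalProjectionOnto = stdGaussian W := by
  have : IsProbabilityMeasure ((stdGaussian E).map W.orthogonalProjectionOnto) :=
    Measure.isProbabilityMeasure_map (by fun_prop)
  refine Measure.ext_of_charFun (funext fun t => ?_)
  have hinner : ∀ z : E, inner ℝ (W.orthogonalProjectionOnto z) t = inner ℝ z (t : E) :=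
    fun z => Submodule.inner_orthogonalProjectionOnto_eq_of_mem_right t z
  rw [charFun_stdGaussian, charFun_apply, integral_map (by fun_prop)
    (Measurable.aestronglyMeasurable (by fun_prop))]
  simp_rw [hinner]
  rw [← charFun_apply, charFun_stdGaussian, Submodule.coe_norm]

lemma map_inv_norm_smul_withDensity_comp_norm [Nontrivial E] {f : ℝ → ENNReal}
    (hf : Measurable f) :
    ((volume : Measure E).withDensity fun z => f ‖z‖).map (fun z => ‖z‖⁻¹ • z)
      = (∫⁻ r : Set.Ioi (0 : ℝ), f r ∂.volumeIoiPow (Module.finrank ℝ E - 1)) •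
        (volume : Measure E).toSphere.map Subtype.val := by
  refine Measure.ext_of_lintegral _ fun g hg => ?_
  rw [lintegral_map hg (by fun_prop),
    lintegral_withDensity_eq_lintegral_mul _ (by fun_prop) (by fun_prop), lintegral_smul_measure,
    lintegral_map hg measurable_subtype_coe]
  calc ∫⁻ z : E, f ‖z‖ * g (‖z‖⁻¹ • z)
      = ∫⁻ z : ({(0 : E)}ᶜ : Set E), f ‖(z : E)‖ * g (‖(z : E)‖⁻¹ • (z : E))
          ∂((volume : Measure E).comap (↑)) := by
        rw [lintegral_subtype_comap (measurableSet_singleton _).compl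
          fun z : E => f ‖z‖ * g (‖z‖⁻¹ • z), restrict_compl_singleton]
    _ = ∫⁻ x : Metric.sphere (0 : E) 1 × Set.Ioi (0 : ℝ), g x.1 * f x.2
          ∂((volume : Measure E).toSphere.prod (.volumeIoiPow (Module.finrank ℝ E - 1))) := by
        rw [← (volume : Measure E).measurePreserving_homeomorphUnitSphereProd.lintegral_comp_emb
          (Homeomorph.measurableEmbedding _)]
        simp [mul_comm]
    _ = _ := by
        rw [lintegral_prod_mul (f := fun x : Metric.sphere (0 : E) 1 => g x)
          (g := fun r : Set.Ioi (0 : ℝ) => f r) (by fun_prop) (by fun_prop), mul_comm, smul_eq_mul]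

/-- The density of the standard Gaussian law on a `d`-dimensional Euclidean space, as a function
of the norm. -/
noncomputable def stdGaussianRadialPDF (d : ℕ) (r : ℝ) : ℝ :=
  ((2 * Real.pi) ^ ((d : ℝ) / 2))⁻¹ * Real.exp (-r ^ 2 / 2)

@[fun_prop]
lemma continuous_stdGaussianRadialPDF (d : ℕ) : Continuous (stdGaussianRadialPDF d) := by
  unfold stdGaussianRadialPDF
  fun_prop

lemma stdGaussianRadialPDF_nonneg (d : ℕ) (r : ℝ) : 0 ≤ stdGaussianRadialPDF d r := by
  unfold stdGaussianRadialPDF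
  positivity

lemma integrable_stdGaussianRadialPDF_norm (d : ℕ) :
    Integrable fun z : E => stdGaussianRadialPDF d ‖z‖ := by
  have h := (GaussianFourier.integrable_cexp_neg_mul_sq_norm_add (V := E) (b := 1 / 2)
    (by norm_num) 0 0).norm
  refine (h.const_mul ((2 * Real.pi) ^ ((d : ℝ) / 2))⁻¹).congr (ae_of_all _ fun z => ?_)
  simp only [stdGaussianRadialPDF, Complex.norm_exp]
  congr 2
  simp [← Complex.ofReal_pow]
  ring

lemma integral_stdGaussianRadialPDF_norm_smul_cexp (t : E) :
    ∫ z : E, stdGaussianRadialPDF (Module.finrank ℝ E) ‖z‖ • Complex.exp (inner ℝ z t * Complex.I)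
      = Complex.exp (-‖t‖ ^ 2 / 2) := by
  have hfourier := GaussianFourier.integral_cexp_neg_mul_sq_norm_add (V := E) (b := 1 / 2)
    (by norm_num) Complex.I t
  have hpi : ((Real.pi : ℂ) / (1 / 2)) ^ ((Module.finrank ℝ E : ℂ) / 2)
      = (((2 * Real.pi) ^ ((Module.finrank ℝ E : ℝ) / 2) : ℝ) : ℂ) := by
    rw [Complex.ofReal_cpow (by positivity)]
    push_cast
    ring_nf
  have hne : (((2 * Real.pi) ^ ((Module.finrank ℝ E : ℝ) / 2) : ℝ) : ℂ) ≠ 0 :=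
    Complex.ofReal_ne_zero.2 (by positivity)
  have hintegrand : ∀ z : E, stdGaussianRadialPDF (Module.finrank ℝ E) ‖z‖ •
      Complex.exp (inner ℝ z t * Complex.I)
      = (((2 * Real.pi) ^ ((Module.finrank ℝ E : ℝ) / 2) : ℝ) : ℂ)⁻¹ *
        Complex.exp (-(1 / 2) * (‖z‖ : ℂ) ^ 2 + Complex.I * inner ℝ t z) := fun z => by
    rw [stdGaussianRadialPDF, Complex.real_smul, Complex.ofReal_mul, Complex.ofReal_exp,
      Complex.ofReal_inv, mul_assoc, ← Complex.exp_add, real_inner_comm]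
    push_cast
    ring_nf
  simp_rw [hintegrand]
  rw [integral_const_mul, hfourier, hpi, inv_mul_cancel_left₀ hne, Complex.I_sq]
  ring_nf

lemma stdGaussian_eq_withDensity :
    stdGaussian E = (volume : Measure E).withDensity
      fun z => ENNReal.ofReal (stdGaussianRadialPDF (Module.finrank ℝ E) ‖z‖) := by
  have := isFiniteMeasure_withDensity_ofReal
    (integrable_stdGaussianRadialPDF_norm (E := E) (Module.finrank ℝ E)).hasFiniteIntegral
  refine Measure.ext_of_charFun (funext fun t => ?_)
  rw [charFun_stdGaussian, charFun_apply,
    integral_withDensity_eq_integral_toReal_smul (by fun_prop) (by simp)]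
  simp only [ENNReal.toReal_ofReal (stdGaussianRadialPDF_nonneg _ _),
    integral_stdGaussianRadialPDF_norm_smul_cexp]

end StdGaussian

lemma uniformSphere_eq_map_stdGaussian {n : ℕ} (hn : n ≠ 0) :
    uniformSphere n = (stdGaussian (EuclideanSpace ℝ (Fin n))).map fun z => ‖z‖⁻¹ • z := by
  have : Nonempty (Fin n) := ⟨⟨0, Nat.pos_of_ne_zero hn⟩⟩
  have hpolar := map_inv_norm_smul_withDensity_comp_norm (E := EuclideanSpace ℝ (Fin n))
    (f := fun r => ENNReal.ofReal (stdGaussianRadialPDF n r)) (by fun_prop)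
  have hstd := stdGaussian_eq_withDensity (E := EuclideanSpace ℝ (Fin n))
  rw [finrank_euclideanSpace_fin] at hstd
  rw [← hstd] at hpolar
  have hmass := congrArg (· Set.univ) hpolar
  simp only [Measure.map_apply (show Measurable fun z : EuclideanSpace ℝ (Fin n) => ‖z‖⁻¹ • z by
    fun_prop) MeasurableSet.univ, Set.preimage_univ, measure_univ, Measure.smul_apply, smul_eq_mul,
    Measure.map_apply measurable_subtype_coe MeasurableSet.univ] at hmass
  rw [hpolar, uniformSphere, Measure.map_smul, ENNReal.eq_inv_of_mul_eq_one_left hmass.symm]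

lemma map_inner_sq_uniformSphere {n : ℕ} (hn : 2 ≤ n) {u : EuclideanSpace ℝ (Fin n)}
    (hu : ‖u‖ = 1) :
    (uniformSphere n).map (fun l => inner ℝ l u ^ 2) = betaMeasure (1 / 2) (((n : ℝ) - 1) / 2) := by
  obtain ⟨m, rfl⟩ : ∃ m, n = m + 1 := ⟨n - 1, by omega⟩
  have hu0 : u ≠ 0 := norm_ne_zero_iff.1 (hu ▸ one_ne_zero)
  rw [Nat.cast_succ, add_sub_cancel_right,
    ← map_cos_sq_angle_stdGaussian (m := m) (by omega) finrank_euclideanSpace_fin hu0,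
    uniformSphere_eq_map_stdGaussian (by omega), Measure.map_map (by fun_prop) (by fun_prop)]
  congr 1
  ext z
  rw [Function.comp_apply, InnerProductGeometry.cos_angle, hu, mul_one, real_inner_smul_left,
    div_eq_inv_mul]

lemma gaussianReal_eq_map_affine (m : ℝ) (v : NNReal) :
    gaussianReal m v = (gaussianReal 0 1).map fun z => √(v : ℝ) * z + m := by
  have hscale := gaussianReal_map_const_mul (μ := 0) (v := 1) √(v : ℝ)
  rw [mul_zero, mul_one] at hscale
  have hcomp : (fun z => √(v : ℝ) * z + m) = (fun z => z + m) ∘ fun z => √(v : ℝ) * z := rfl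
  rw [hcomp, ← Measure.map_map (by fun_prop) (by fun_prop), hscale, gaussianReal_map_add_const,
    zero_add]
  congr 1
  ext
  simp

lemma pi_gaussianReal_eq_map_affine {ι : Type*} [Fintype ι] (m : ℝ) (v : NNReal) :
    Measure.pi (fun _ : ι => gaussianReal m v)
      = (Measure.pi fun _ : ι => gaussianReal 0 1).map fun z i => √(v : ℝ) * z i + m := by
  have : IsProbabilityMeasure ((gaussianReal 0 1).map fun z => √(v : ℝ) * z + m) :=
    Measure.isProbabilityMeasure_map (by fun_prop)
  rw [gaussianReal_eq_map_affine]
  exact (Measure.pi_map_pi (f := fun _ z => √(v : ℝ) * z + m) fun _ => by fun_prop).symm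

section SampleCorrelation

variable {n : ℕ}

lemma sampleMean_affine (hn : n ≠ 0) (s c : ℝ) (z : Fin n → ℝ) :
    sampleMean (fun i => s * z i + c) = s * sampleMean z + c := by
  have hn' : (n : ℝ) ≠ 0 := Nat.cast_ne_zero.2 hn
  simp only [sampleMean, Finset.sum_add_distrib, ← Finset.mul_sum, Finset.sum_const,
    Finset.card_univ, Fintype.card_fin, nsmul_eq_mul]
  field_simp

lemma sampleCorr_affine (hn : n ≠ 0) {s : ℝ} (hs : 0 < s) (c : ℝ) (z y : Fin n → ℝ) :
    sampleCorr (fun i => s * z i + c) y = sampleCorr z y := by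
  have hcenter : ∀ i, s * z i + c - (s * sampleMean z + c) = s * (z i - sampleMean z) :=
    fun i => by ring
  simp only [sampleCorr, sampleMean_affine hn, hcenter, mul_pow, mul_assoc, ← Finset.mul_sum]
  rw [Real.sqrt_mul (sq_nonneg s), Real.sqrt_sq hs.le, mul_assoc, mul_div_mul_left _ _ hs.ne']

/-- The hyperplane of centered samples, i.e. the orthogonal complement of the constants in `ℝⁿ`.
Centering a sample is projecting it orthogonally onto this hyperplane. -/
noncomputable def centeredSubspace (n : ℕ) : Submodule ℝ (EuclideanSpace ℝ (Fin n)) :=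
  (ℝ ∙ (WithLp.toLp 2 fun _ => 1 : EuclideanSpace ℝ (Fin n)))ᗮ

lemma finrank_centeredSubspace (n : ℕ) : Module.finrank ℝ (centeredSubspace (n + 1)) = n := by
  have : Fact (Module.finrank ℝ (EuclideanSpace ℝ (Fin (n + 1))) = n + 1) := ⟨by simp⟩
  refine Submodule.finrank_orthogonal_span_singleton fun h => ?_
  exact one_ne_zero (congrArg (fun z : EuclideanSpace ℝ (Fin (n + 1)) => z 0) h)

lemma orthogonalProjectionOnto_centeredSubspace_apply (z : EuclideanSpace ℝ (Fin n)) (i : Fin n) :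
    ((centeredSubspace n).orthogonalProjectionOnto z : EuclideanSpace ℝ (Fin n)) i
      = z i - sampleMean z := by
  have hn : (n : ℝ) ≠ 0 := Nat.cast_ne_zero.2 (Fin.pos i).ne'
  suffices h : (centeredSubspace n).starProjection z = WithLp.toLp 2 fun i => z i - sampleMean z by
    rw [← Submodule.starProjection_apply, h]
  refine Submodule.eq_starProjection_of_mem_orthogonal ?_ ?_
  · rw [centeredSubspace, Submodule.mem_orthogonal_singleton_iff_inner_right]
    simp only [PiLp.inner_apply, sampleMean, RCLike.inner_apply, conj_trivial, mul_one,
      Finset.sum_sub_distrib, Finset.sum_const, Finset.card_univ, Fintype.card_fin, nsmul_eq_mul]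
    field_simp
    ring
  · rw [centeredSubspace, Submodule.orthogonal_orthogonal, Submodule.mem_span_singleton]
    refine ⟨sampleMean z, ?_⟩
    ext i
    simp

lemma sampleCorr_eq_cos_angle (z y : EuclideanSpace ℝ (Fin n)) :
    sampleCorr z y = Real.cos (InnerProductGeometry.angle
      ((centeredSubspace n).orthogonalProjectionOnto z)
      ((centeredSubspace n).orthogonalProjectionOnto y)) := by
  rw [InnerProductGeometry.cos_angle, Submodule.coe_inner, ← Submodule.norm_coe,
    ← Submodule.norm_coe, EuclideanSpace.norm_eq, EuclideanSpace.norm_eq, PiLp.inner_apply]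
  simp only [orthogonalProjectionOnto_centeredSubspace_apply, sampleCorr, RCLike.inner_apply,
    conj_trivial, Real.norm_eq_abs, sq_abs, mul_comm]

lemma orthogonalProjectionOnto_centeredSubspace_ne_zero {y : Fin n → ℝ}
    (hy : ∃ i i', y i ≠ y i') :
    (centeredSubspace n).orthogonalProjectionOnto (WithLp.toLp 2 y) ≠ 0 := by
  intro h
  obtain ⟨i, i', hi⟩ := hy
  have hmean : ∀ k, y k = sampleMean y := fun k => by
    have := orthogonalProjectionOnto_centeredSubspace_apply (WithLp.toLp 2 y) k
    rw [h, Submodule.coe_zero, PiLp.zero_apply] at this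
    exact sub_eq_zero.1 this.symm
  exact hi ((hmean i).trans (hmean i').symm)

@[fun_prop]
lemma measurable_sampleCorr :
    Measurable fun xy : (Fin n → ℝ) × (Fin n → ℝ) => sampleCorr xy.1 xy.2 := by
  unfold sampleCorr sampleMean
  fun_prop

lemma map_sampleCorr_sq_pi_gaussianReal (hn : 3 ≤ n) (m : ℝ) {v : NNReal} (hv : v ≠ 0)
    {y : Fin n → ℝ} (hy : ∃ i i', y i ≠ y i') :
    (Measure.pi fun _ : Fin n => gaussianReal m v).map (fun x => sampleCorr x y ^ 2)
      = betaMeasure (1 / 2) (((n : ℝ) - 2) / 2) := by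
  obtain ⟨k, rfl⟩ : ∃ k, n = k + 2 := ⟨n - 2, by omega⟩
  have hsd : 0 < √(v : ℝ) := Real.sqrt_pos.2 (by positivity)
  have hmeas : Measurable fun x => sampleCorr x y ^ 2 :=
    (measurable_sampleCorr.comp (measurable_id.prodMk measurable_const)).pow_const 2
  rw [pi_gaussianReal_eq_map_affine, Measure.map_map hmeas (by fun_prop)]
  simp only [Function.comp_def, sampleCorr_affine (show k + 2 ≠ 0 by omega) hsd]
  rw [Nat.cast_add, Nat.cast_ofNat, add_sub_cancel_right,
    ← map_cos_sq_angle_stdGaussian (by omega) (finrank_centeredSubspace (k + 1))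
      (orthogonalProjectionOnto_centeredSubspace_ne_zero hy),
    ← map_orthogonalProjectionOnto_stdGaussian, Measure.map_map (by fun_prop) (by fun_prop),
    ← map_pi_eq_stdGaussian, Measure.map_map (by fun_prop) (by fun_prop)]
  congr 1
  ext z
  exact congrArg (· ^ 2) (sampleCorr_eq_cos_angle (WithLp.toLp 2 z) (WithLp.toLp 2 y))

end SampleCorrelation

lemma iSup_abs_sq_lt_iff {ι : Type*} [Finite ι] [Nonempty ι] (f : ι → ℝ) (θ : ℝ) :
    (⨆ j, |f j|) ^ 2 < θ ↔ ∀ j, f j ^ 2 < θ := by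
  constructor
  · intro h j
    refine lt_of_le_of_lt ?_ h
    rw [← sq_abs]
    gcongr
    exact le_ciSup (f := fun j => |f j|) (Set.finite_range _).bddAbove j
  · intro h
    obtain ⟨j, hj⟩ := exists_eq_ciSup_of_finite (f := fun j => |f j|)
    rw [← hj, sq_abs]
    exact h j

section IndependentMaximum

variable {Ω α β ι : Type*} [MeasurableSpace Ω] [MeasurableSpace α] [MeasurableSpace β] [Fintype ι]
  {μ : Measure Ω}

lemma measure_forall_mem_of_indepFun [IsFiniteMeasure μ] {V : Ω → ι → α} {W : Ω → β}
    (hV : AEMeasurable V μ) (hW : AEMeasurable W μ) (hVW : IndepFun V W μ)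
    {ν : ι → Measure α} [∀ j, SigmaFinite (ν j)] (hlaw : μ.map V = Measure.pi ν)
    {S : Set (α × β)} (hS : MeasurableSet S) {B : Set β} (hB : MeasurableSet B) {c : ENNReal}
    (hc : ∀ w ∈ B, ∀ j, ν j {v | (v, w) ∈ S} = c) :
    μ {ω | W ω ∈ B ∧ ∀ j, (V ω j, W ω) ∈ S} = c ^ Fintype.card ι * μ (W ⁻¹' B) := by
  set T : Set ((ι → α) × β) := {x | x.2 ∈ B ∧ ∀ j, (x.1 j, x.2) ∈ S}
  have hT : MeasurableSet T := by
    simp only [T, Set.ofPred_and, Set.ofPred_forall]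
    exact (measurable_snd hB).inter (MeasurableSet.iInter fun j => (by fun_prop :
      Measurable fun x : (ι → α) × β => (x.1 j, x.2)) hS)
  have hslice : ∀ w, Measure.pi ν ((fun x => (x, w)) ⁻¹' T)
      = B.indicator (fun _ => c ^ Fintype.card ι) w := by
    intro w
    by_cases hw : w ∈ B
    · have hpi : (fun x => (x, w)) ⁻¹' T = Set.univ.pi fun _ => {v | (v, w) ∈ S} := by
        ext x; simp [T, hw]
      rw [hpi, Measure.pi_pi, Set.indicator_of_mem hw]
      simp [hc w hw]
    · simp [T, hw]
  have hjoint := (indepFun_iff_map_prod_eq_prod_map_map hV hW).1 hVW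
  calc μ ((fun ω => (V ω, W ω)) ⁻¹' T)
      = ((Measure.pi ν).prod (μ.map W)) T := by
        rw [← hlaw, ← hjoint, Measure.map_apply_of_aemeasurable (hV.prodMk hW) hT]
    _ = ∫⁻ w, B.indicator (fun _ => c ^ Fintype.card ι) w ∂μ.map W := by
        simp only [Measure.prod_apply_symm hT, hslice]
    _ = c ^ Fintype.card ι * μ (W ⁻¹' B) := by
        rw [lintegral_indicator_const hB, Measure.map_apply_of_aemeasurable hW hB]

lemma measure_iSup_abs_sq_lt_of_indepFun [IsFiniteMeasure μ] [Nonempty ι] {V : Ω → ι → α}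
    {W : Ω → β} (hV : AEMeasurable V μ) (hW : AEMeasurable W μ) (hVW : IndepFun V W μ)
    {ν : ι → Measure α} [∀ j, SigmaFinite (ν j)] (hlaw : μ.map V = Measure.pi ν)
    {f : α × β → ℝ} (hf : Measurable f) {B : Set β} (hB : MeasurableSet B) {ρ : Measure ℝ}
    (hρ : ∀ w ∈ B, ∀ j, (ν j).map (fun v => f (v, w) ^ 2) = ρ) (θ : ℝ) :
    μ (W ⁻¹' B ∩ {ω | (⨆ j, |f (V ω j, W ω)|) ^ 2 < θ})
      = ρ (Set.Iio θ) ^ Fintype.card ι * μ (W ⁻¹' B) := by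
  rw [← measure_forall_mem_of_indepFun hV hW hVW hlaw (S := {x | f x ^ 2 < θ})
    (measurableSet_lt (by fun_prop) measurable_const) hB]
  · congr 1
    ext ω
    exact and_congr_right fun _ => iSup_abs_sq_lt_iff _ θ
  · intro w hw j
    rw [← hρ w hw j, Measure.map_apply (by fun_prop) measurableSet_Iio]
    rfl

end IndependentMaximum

lemma IsSphereSample.measureReal_maxInner_sq_lt {Ω : Type u} [MeasurableSpace Ω] {μ : Measure Ω}
    [IsProbabilityMeasure μ] {p n : ℕ} (hp : p ≠ 0) (hn : 2 ≤ n)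
    {L : Fin p → Ω → EuclideanSpace ℝ (Fin n)} {U : Ω → EuclideanSpace ℝ (Fin n)}
    (h : IsSphereSample L U μ) (θ : ℝ) :
    μ.real {ω | maxInner L U ω ^ 2 < θ}
      = (betaMeasure (1 / 2) (((n : ℝ) - 1) / 2)).real (Set.Iio θ) ^ p := by
  have : NeZero p := ⟨hp⟩
  have hL : ∀ j, AEMeasurable (L j) μ := fun j => (h.law_L j).aemeasurable
  have : IsProbabilityMeasure (uniformSphere n) := by
    rw [← (h.law_L 0).map_eq]
    exact Measure.isProbabilityMeasure_map (hL 0)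
  have hlaw : μ.map (fun ω j => L j ω) = Measure.pi fun _ => uniformSphere n := by
    simp only [(iIndepFun_iff_map_fun_eq_pi_map hL).1 h.indep_L, (h.law_L _).map_eq]
  have hU : U ⁻¹' {u | ‖u‖ = 1} =ᵐ[μ] Set.univ := eventuallyEq_univ.2 h.norm_U
  have hmax := measure_iSup_abs_sq_lt_of_indepFun (aemeasurable_pi_lambda _ hL) h.aemeasurable_U
    h.indep_L_U hlaw (f := fun x => inner ℝ x.1 x.2) (by fun_prop) (B := {u | ‖u‖ = 1})
    (measurableSet_eq_fun (by fun_prop) (by fun_prop))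
    (fun u hu _ => map_inner_sq_uniformSphere hn hu) θ
  rw [measure_congr (inter_ae_eq_right_of_ae_eq_univ hU), measure_congr hU, measure_univ, mul_one,
    Fintype.card_fin] at hmax
  rw [measureReal_def, measureReal_def, ← ENNReal.toReal_pow, ← hmax]
  rfl

section Conditioning

variable {Ω : Type*} [MeasurableSpace Ω] {μ : Measure Ω} {D : Set Ω}

lemma measureReal_mul_cond_real [IsFiniteMeasure μ] (hD : NullMeasurableSet D μ) (S : Set Ω) :
    μ.real D * (cond μ D).real S = μ.real (S ∩ D) := by
  rw [measureReal_def (cond μ D), ProbabilityTheory.cond, Measure.smul_apply,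
    Measure.restrict_apply₀' hD, smul_eq_mul, ENNReal.toReal_mul, ENNReal.toReal_inv,
    ← measureReal_def, ← measureReal_def]
  rcases eq_or_ne (μ.real D) 0 with h0 | h0
  · rw [h0, zero_mul, measureReal_mono_null Set.inter_subset_right h0]
  · rw [mul_inv_cancel_left₀ h0]

lemma abs_measureReal_sub_cond_real_le [IsProbabilityMeasure μ] (hD : NullMeasurableSet D μ)
    (S : Set Ω) : |μ.real S - (cond μ D).real S| ≤ 1 - μ.real D := by
  have hsplit := measureReal_inter_add_sdiff₀ (μ := μ) (s := S) hD
  have hinter := measureReal_mul_cond_real hD S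
  have hdiff : μ.real (S \ D) ≤ 1 - μ.real D :=
    (measureReal_mono fun _ h => h.2).trans_eq (probReal_compl_eq_one_sub₀ hD)
  have hcond0 : 0 ≤ (cond μ D).real S := measureReal_nonneg
  have hcond1 : (cond μ D).real S ≤ 1 := measureReal_le_one
  have hD1 : μ.real D ≤ 1 := measureReal_le_one
  have hdiff0 : 0 ≤ μ.real (S \ D) := measureReal_nonneg
  rw [abs_le]
  constructor <;> nlinarith

end Conditioning

section GaussianDesign

/-- `p` independent columns of `n` i.i.d. nondegenerate Gaussian observations, together with an
independent random vector `Y` of `ℝⁿ` of arbitrary joint law: the observations of `Y` may be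
dependent and have different laws. -/
structure IsGaussianDesign {Ω : Type u} [MeasurableSpace Ω] {p n : ℕ}
    (X : Fin n → Fin p → Ω → ℝ) (Y : Fin n → Ω → ℝ) (μ : Measure Ω) : Prop where
  law_X : ∀ j, ∃ (m : ℝ) (v : NNReal), v ≠ 0 ∧ ∀ i, HasLaw (X i j) (gaussianReal m v) μ
  indep_X : iIndepFun (fun ij : Fin n × Fin p => X ij.1 ij.2) μ
  aemeasurable_Y : AEMeasurable (fun ω i => Y i ω) μ
  indep_X_Y : IndepFun (fun ω (ij : Fin n × Fin p) => X ij.1 ij.2 ω) (fun ω i => Y i ω) μ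

lemma map_swap_pi {ι κ α : Type*} [Fintype ι] [Fintype κ] [MeasurableSpace α]
    (ν : κ → Measure α) [∀ j, SigmaFinite (ν j)] :
    (Measure.pi fun ij : ι × κ => ν ij.2).map (fun x j i => x (i, j))
      = Measure.pi fun j => Measure.pi fun _ : ι => ν j := by
  have h : (Measure.pi fun j => Measure.pi fun _ : ι => ν j).map (fun x (ij : ι × κ) => x ij.2 ij.1)
      = Measure.pi fun ij : ι × κ => ν ij.2 := by
    refine (Measure.pi_eq fun s hs => ?_).symm
    have hbox : (fun (x : κ → ι → α) (ij : ι × κ) => x ij.2 ij.1) ⁻¹' Set.univ.pi s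
        = Set.univ.pi fun j => Set.univ.pi fun i => s (i, j) := by
      ext x
      simp only [Set.mem_preimage, Set.mem_univ_pi, Prod.forall]
      exact forall_comm
    rw [Measure.map_apply (by fun_prop) (MeasurableSet.univ_pi hs), hbox, Measure.pi_pi,
      Fintype.prod_prod_type_right]
    simp only [Measure.pi_pi]
  rw [← h, Measure.map_map (by fun_prop) (by fun_prop)]
  exact Measure.map_id

lemma measurableSet_exists_ne (n : ℕ) : MeasurableSet {y : Fin n → ℝ | ∃ i i', y i ≠ y i'} := by
  simp only [Set.ofPred_exists]
  exact MeasurableSet.iUnion fun i => MeasurableSet.iUnion fun i' =>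
    (measurableSet_eq_fun (by fun_prop) (by fun_prop)).compl

variable {Ω : Type u} [MeasurableSpace Ω] {μ : Measure Ω} {p n : ℕ} {X : Fin n → Fin p → Ω → ℝ}
  {Y : Fin n → Ω → ℝ}

lemma IsGaussianSample.isGaussianDesign (h : IsGaussianSample X Y μ) : IsGaussianDesign X Y μ where
  law_X := h.law_X
  indep_X := h.indep_X
  aemeasurable_Y := aemeasurable_pi_lambda _ fun i => (h.identDistrib_Y i i).aemeasurable_fst
  indep_X_Y := h.indep_X_Y

lemma IsGaussianDesign.nullMeasurableSet_nonconst (h : IsGaussianDesign X Y μ) :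
    NullMeasurableSet (nonconst Y) μ :=
  h.aemeasurable_Y.nullMeasurableSet_preimage (measurableSet_exists_ne n)

lemma IsGaussianDesign.exists_map_eq_pi_pi [IsProbabilityMeasure μ] (h : IsGaussianDesign X Y μ) :
    ∃ (m : Fin p → ℝ) (v : Fin p → NNReal), (∀ j, v j ≠ 0) ∧ μ.map (fun ω j i => X i j ω)
      = Measure.pi fun j => Measure.pi fun _ : Fin n => gaussianReal (m j) (v j) := by
  choose m v hv hX using h.law_X
  have hXm : ∀ ij : Fin n × Fin p, AEMeasurable (X ij.1 ij.2) μ :=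
    fun ij => (hX ij.2 ij.1).aemeasurable
  have hlaw : μ.map (fun ω (ij : Fin n × Fin p) => X ij.1 ij.2 ω)
      = Measure.pi fun ij : Fin n × Fin p => gaussianReal (m ij.2) (v ij.2) := by
    simp only [(iIndepFun_iff_map_fun_eq_pi_map hXm).1 h.indep_X, (hX _ _).map_eq]
  refine ⟨m, v, hv, ?_⟩
  rw [← map_swap_pi, ← hlaw, AEMeasurable.map_map_of_aemeasurable
    (Measurable.aemeasurable (by fun_prop)) (aemeasurable_pi_lambda _ hXm)]
  rfl

lemma IsGaussianDesign.measure_nonconst_inter_maxCorr_sq_lt [IsProbabilityMeasure μ]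
    (hp : p ≠ 0) (hn : 3 ≤ n) (h : IsGaussianDesign X Y μ) (θ : ℝ) :
    μ (nonconst Y ∩ {ω | maxCorr X Y ω ^ 2 < θ})
      = betaMeasure (1 / 2) (((n : ℝ) - 2) / 2) (Set.Iio θ) ^ p * μ (nonconst Y) := by
  have : NeZero p := ⟨hp⟩
  obtain ⟨m, v, hv, hlaw⟩ := h.exists_map_eq_pi_pi
  have hX : AEMeasurable (fun ω j i => X i j ω) μ := aemeasurable_pi_lambda _ fun j =>
    aemeasurable_pi_lambda _ fun i => ((h.law_X j).choose_spec.choose_spec.2 i).aemeasurable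
  have hswap : Measurable fun (x : Fin n × Fin p → ℝ) j i => x (i, j) := by fun_prop
  have hmax := measure_iSup_abs_sq_lt_of_indepFun hX h.aemeasurable_Y
    (h.indep_X_Y.comp hswap measurable_id) hlaw measurable_sampleCorr (measurableSet_exists_ne n)
    (fun y hy j => map_sampleCorr_sq_pi_gaussianReal hn (m j) (hv j) hy) θ
  rwa [Fintype.card_fin] at hmax

lemma IsGaussianDesign.cond_real_maxCorr_sq_lt [IsProbabilityMeasure μ] (hp : p ≠ 0) (hn : 3 ≤ n)
    (h : IsGaussianDesign X Y μ) (hY : μ (nonconst Y) ≠ 0) (θ : ℝ) :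
    (cond μ (nonconst Y)).real {ω | maxCorr X Y ω ^ 2 < θ}
      = (betaMeasure (1 / 2) (((n : ℝ) - 2) / 2)).real (Set.Iio θ) ^ p := by
  have hY0 : μ.real (nonconst Y) ≠ 0 := (measureReal_ne_zero_iff).2 hY
  refine mul_left_cancel₀ hY0 ?_
  rw [measureReal_mul_cond_real h.nullMeasurableSet_nonconst, Set.inter_comm, measureReal_def,
    h.measure_nonconst_inter_maxCorr_sq_lt hp hn, ENNReal.toReal_mul, ENNReal.toReal_pow, mul_comm]
  rfl

end GaussianDesign

section BetaTail

variable {a b r : ℝ}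

lemma betaPDFReal_nonneg (ha : 0 < a) (hb : 0 < b) (x : ℝ) : 0 ≤ betaPDFReal a b x := by
  by_cases hx : 0 < x ∧ x < 1
  · exact (betaPDFReal_pos hx.1 hx.2 ha hb).le
  · rw [betaPDFReal, if_neg hx]

lemma betaMeasure_real_Ici (ha : 0 < a) (hb : 0 < b) (hr0 : 0 ≤ r) (hr1 : r ≤ 1) :
    (betaMeasure a b).real (Set.Ici (1 - r))
      = (∫ u in (0 : ℝ)..r, u ^ (b - 1) * (1 - u) ^ (a - 1)) / beta a b := by
  have hdensity : Set.EqOn (betaPDFReal a b)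
      (fun x => (1 - x) ^ (b - 1) * (1 - (1 - x)) ^ (a - 1) / beta a b) (Set.Ioo (1 - r) 1) := by
    intro x hx
    rw [betaPDFReal, if_pos ⟨(sub_nonneg.2 hr1).trans_lt hx.1, hx.2⟩]
    simp only [sub_sub_cancel]
    ring
  have hvanish : ∀ x ∈ Set.Ici (1 - r) \ Set.Ico (1 - r) 1, betaPDFReal a b x = 0 := by
    intro x hx
    have hx1 : 1 ≤ x := le_of_not_gt fun h => hx.2 ⟨hx.1, h⟩
    exact if_neg fun h => hx1.not_gt h.2
  calc (betaMeasure a b).real (Set.Ici (1 - r))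
      = ∫ x in Set.Ici (1 - r), betaPDFReal a b x := by
        rw [measureReal_def, betaMeasure, withDensity_apply _ measurableSet_Ici]
        exact (integral_eq_lintegral_of_nonneg_ae (ae_of_all _ (betaPDFReal_nonneg ha hb))
          (Measurable.aestronglyMeasurable (by fun_prop))).symm
    _ = ∫ x in Set.Ioo (1 - r) 1, betaPDFReal a b x := by
        rw [setIntegral_eq_of_subset_of_forall_sdiff_eq_zero measurableSet_Ici
          Set.Ico_subset_Ici_self hvanish, integral_Ico_eq_integral_Ioo]
    _ = ∫ x in (1 - r)..(1 - 0), (1 - x) ^ (b - 1) * (1 - (1 - x)) ^ (a - 1) / beta a b := by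
        rw [setIntegral_congr_fun measurableSet_Ioo hdensity, sub_zero,
          intervalIntegral.integral_of_le (sub_le_self 1 hr0), integral_Ioc_eq_integral_Ioo]
    _ = (∫ u in (0 : ℝ)..r, u ^ (b - 1) * (1 - u) ^ (a - 1)) / beta a b := by
        rw [intervalIntegral.integral_div, ← intervalIntegral.integral_comp_sub_left
          (fun x => (1 - x) ^ (b - 1) * (1 - (1 - x)) ^ (a - 1))]
        simp only [sub_sub_cancel]

-- For `a ≤ 1` the last factor increases from its value `b` at `0`: comparing it with its values at
-- `0` and `r` sandwiches the integral over `[0, r]` of the power factors, which is the Beta tail.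
lemma hasDerivAt_rpow_mul_one_sub_rpow (a b : ℝ) {u : ℝ} (hu0 : 0 < u) (hu1 : u < 1) :
    HasDerivAt (fun u => u ^ b * (1 - u) ^ (a - 1))
      (u ^ (b - 1) * (1 - u) ^ (a - 1) * (b + (1 - a) * (u / (1 - u)))) u := by
  have h1u : 0 < 1 - u := sub_pos.2 hu1
  refine ((Real.hasDerivAt_rpow_const (p := b) (Or.inl hu0.ne')).mul
    (((hasDerivAt_id u).const_sub 1).rpow_const (p := a - 1) (Or.inl h1u.ne'))).congr_deriv ?_
  simp only [id, Real.rpow_sub_one h1u.ne' (a - 1), Real.rpow_sub_one hu0.ne']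
  field_simp
  ring

lemma continuousOn_rpow_mul_one_sub_rpow (a : ℝ) (hb : 0 ≤ b) (hr1 : r < 1) :
    ContinuousOn (fun u : ℝ => u ^ b * (1 - u) ^ (a - 1)) (Set.Icc 0 r) :=
  ((Real.continuous_rpow_const hb).continuousOn).mul <|
    ContinuousOn.rpow_const (by fun_prop) fun _ hu => Or.inl (sub_pos.2 (hu.2.trans_lt hr1)).ne'

lemma integral_deriv_rpow_mul_one_sub_rpow (ha : a ≤ 1) (hb : 0 < b) (hr0 : 0 ≤ r) (hr1 : r < 1) :
    IntervalIntegrable (fun u => u ^ (b - 1) * (1 - u) ^ (a - 1) * (b + (1 - a) * (u / (1 - u))))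
      volume 0 r ∧
    ∫ u in (0 : ℝ)..r, u ^ (b - 1) * (1 - u) ^ (a - 1) * (b + (1 - a) * (u / (1 - u)))
      = r ^ b * (1 - r) ^ (a - 1) := by
  have hcont := continuousOn_rpow_mul_one_sub_rpow a hb.le hr1
  have hderiv : ∀ u ∈ Set.Ioo 0 r, HasDerivAt (fun u => u ^ b * (1 - u) ^ (a - 1))
      (u ^ (b - 1) * (1 - u) ^ (a - 1) * (b + (1 - a) * (u / (1 - u)))) u :=
    fun u hu => hasDerivAt_rpow_mul_one_sub_rpow a b hu.1 (hu.2.trans hr1)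
  have hint : IntervalIntegrable
      (fun u => u ^ (b - 1) * (1 - u) ^ (a - 1) * (b + (1 - a) * (u / (1 - u)))) volume 0 r := by
    refine intervalIntegral.intervalIntegrable_deriv_of_nonneg
      (g := fun u => u ^ b * (1 - u) ^ (a - 1)) (by rwa [Set.uIcc_of_le hr0])
      (by rwa [min_eq_left hr0, max_eq_right hr0]) fun u hu => ?_
    rw [min_eq_left hr0, max_eq_right hr0] at hu
    have hu0 : 0 < u := hu.1
    have hu1 : 0 < 1 - u := sub_pos.2 (hu.2.trans hr1)
    have : 0 ≤ 1 - a := sub_nonneg.2 ha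
    positivity
  refine ⟨hint, ?_⟩
  rw [intervalIntegral.integral_eq_sub_of_hasDerivAt_of_le hr0 hcont hderiv hint,
    Real.zero_rpow hb.ne', zero_mul, sub_zero]

lemma intervalIntegrable_rpow_mul_one_sub_rpow (a : ℝ) (hb : 0 < b) (hr0 : 0 ≤ r) (hr1 : r < 1) :
    IntervalIntegrable (fun u : ℝ => u ^ (b - 1) * (1 - u) ^ (a - 1)) volume 0 r := by
  refine (intervalIntegral.intervalIntegrable_rpow' (by linarith)).mul_continuousOn ?_
  rw [Set.uIcc_of_le hr0]
  exact ContinuousOn.rpow_const (by fun_prop) fun _ hu =>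
    Or.inl (sub_pos.2 (hu.2.trans_lt hr1)).ne'

lemma mul_betaMeasure_real_Ici_le (ha0 : 0 < a) (ha1 : a ≤ 1) (hb : 0 < b) (hr0 : 0 ≤ r)
    (hr1 : r < 1) :
    b * beta a b * (betaMeasure a b).real (Set.Ici (1 - r)) ≤ r ^ b * (1 - r) ^ (a - 1) := by
  obtain ⟨hint, heq⟩ := integral_deriv_rpow_mul_one_sub_rpow ha1 hb hr0 hr1
  rw [betaMeasure_real_Ici ha0 hb hr0 hr1.le, mul_assoc, mul_div_cancel₀ _ (beta_pos ha0 hb).ne',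
    ← intervalIntegral.integral_const_mul, ← heq]
  refine intervalIntegral.integral_mono_on hr0
    ((intervalIntegrable_rpow_mul_one_sub_rpow a hb hr0 hr1).const_mul b) hint fun u hu => ?_
  have hu0 : 0 ≤ u := hu.1
  have hu1 : 0 < 1 - u := sub_pos.2 (hu.2.trans_lt hr1)
  have hslope : 0 ≤ (1 - a) * (u / (1 - u)) := mul_nonneg (sub_nonneg.2 ha1) (by positivity)
  rw [mul_comm]
  gcongr
  exact le_add_of_nonneg_right hslope

lemma le_mul_betaMeasure_real_Ici (ha0 : 0 < a) (ha1 : a ≤ 1) (hb : 0 < b) (hr0 : 0 ≤ r)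
    (hr1 : r < 1) :
    r ^ b * (1 - r) ^ (a - 1)
      ≤ (b + (1 - a) * (r / (1 - r))) * (beta a b * (betaMeasure a b).real (Set.Ici (1 - r))) := by
  obtain ⟨hint, heq⟩ := integral_deriv_rpow_mul_one_sub_rpow ha1 hb hr0 hr1
  rw [betaMeasure_real_Ici ha0 hb hr0 hr1.le, mul_div_cancel₀ _ (beta_pos ha0 hb).ne',
    ← intervalIntegral.integral_const_mul, ← heq]
  refine intervalIntegral.integral_mono_on hr0 hint
    ((intervalIntegrable_rpow_mul_one_sub_rpow a hb hr0 hr1).const_mul _) fun u hu => ?_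
  have hu0 : 0 ≤ u := hu.1
  have hur : u ≤ r := hu.2
  have hr : 0 < 1 - r := sub_pos.2 hr1
  have hu1 : 0 < 1 - u := hr.trans_le (by linarith)
  have : 0 ≤ 1 - a := sub_nonneg.2 ha1
  rw [mul_comm]
  gcongr

end BetaTail

section CapConst

lemma sqrt_mul_Gamma_add_half_le {b : ℝ} (hb : 0 < b) :
    √b * Real.Gamma (b + 1 / 2) ≤ Real.Gamma (b + 1) := by
  have hΓ := Real.Gamma_pos_of_pos hb
  have hlogConvex := Real.Gamma_mul_add_mul_le_rpow_Gamma_mul_rpow_Gamma hb (add_pos hb one_pos)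
    (one_half_pos (α := ℝ)) one_half_pos (add_halves 1)
  have hmid : 1 / 2 * b + 1 / 2 * (b + 1) = b + 1 / 2 := by ring
  rw [hmid, ← Real.sqrt_eq_rpow, ← Real.sqrt_eq_rpow, Real.Gamma_add_one hb.ne',
    Real.sqrt_mul hb.le, mul_left_comm, Real.mul_self_sqrt hΓ.le] at hlogConvex
  calc √b * Real.Gamma (b + 1 / 2) ≤ √b * (√b * Real.Gamma b) := by gcongr
    _ = Real.Gamma (b + 1) := by
      rw [← mul_assoc, Real.mul_self_sqrt hb.le, Real.Gamma_add_one hb.ne']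

/-- The constant `(d/2) B(1/2, d/2)` with `d = n - 1` in `c_{p,n}`. It normalizes the tail at `1` of
the Beta distribution with parameters `1/2` and `d/2`. -/
noncomputable def capConst (d : ℝ) : ℝ := d / 2 * beta (1 / 2) (d / 2)

variable {d : ℝ}

lemma capConst_eq (hd : 0 < d) :
    capConst d = √Real.pi * Real.Gamma (d / 2 + 1) / Real.Gamma (d / 2 + 1 / 2) := by
  rw [capConst, beta, Real.Gamma_one_half_eq, Real.Gamma_add_one (by positivity), add_comm (1 / 2)]
  ring

lemma sqrt_le_capConst (hd : 0 < d) : √d ≤ capConst d := by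
  have hΓ : 0 < Real.Gamma (d / 2 + 1 / 2) := Real.Gamma_pos_of_pos (by positivity)
  rw [capConst_eq hd, le_div_iff₀ hΓ]
  calc √d * Real.Gamma (d / 2 + 1 / 2)
      ≤ √(Real.pi * (d / 2)) * Real.Gamma (d / 2 + 1 / 2) := by
        gcongr
        nlinarith [Real.two_le_pi]
    _ = √Real.pi * (√(d / 2) * Real.Gamma (d / 2 + 1 / 2)) := by
        rw [Real.sqrt_mul Real.pi_pos.le, mul_assoc]
    _ ≤ √Real.pi * Real.Gamma (d / 2 + 1) := by
        gcongr
        exact sqrt_mul_Gamma_add_half_le (half_pos hd)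

lemma capConst_pos (hd : 0 < d) : 0 < capConst d :=
  (Real.sqrt_pos.2 hd).trans_le (sqrt_le_capConst hd)

lemma capConst_le (hd : 1 ≤ d) : capConst d ≤ 2 * √d := by
  have hd0 : 0 < d := one_pos.trans_le hd
  have hΓ : 0 < Real.Gamma (d / 2 + 1 / 2) := Real.Gamma_pos_of_pos (by positivity)
  have hΓ1 := sqrt_mul_Gamma_add_half_le (b := d / 2 + 1 / 2) (by positivity)
  rw [add_assoc, add_halves, Real.Gamma_add_one (s := d / 2 + 1 / 2) (by positivity)] at hΓ1
  have hΓle : Real.Gamma (d / 2 + 1) ≤ √(d / 2 + 1 / 2) * Real.Gamma (d / 2 + 1 / 2) := by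
    refine le_of_mul_le_mul_left ?_ (Real.sqrt_pos.2 (by positivity : 0 < d / 2 + 1 / 2))
    rwa [← mul_assoc, Real.mul_self_sqrt (by positivity)]
  rw [capConst_eq hd0, div_le_iff₀ hΓ]
  calc √Real.pi * Real.Gamma (d / 2 + 1)
      ≤ √Real.pi * (√(d / 2 + 1 / 2) * Real.Gamma (d / 2 + 1 / 2)) := by gcongr
    _ = √(Real.pi * (d / 2 + 1 / 2)) * Real.Gamma (d / 2 + 1 / 2) := by
        rw [Real.sqrt_mul Real.pi_pos.le, mul_assoc]
    _ ≤ √(2 ^ 2 * d) * Real.Gamma (d / 2 + 1 / 2) := by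
        have : d / 2 + 1 / 2 ≤ d := by linarith
        have : Real.pi ≤ 2 ^ 2 := by linarith [Real.pi_le_four]
        gcongr
    _ = 2 * √d * Real.Gamma (d / 2 + 1 / 2) := by
        rw [Real.sqrt_mul (by positivity), Real.sqrt_sq zero_le_two]

variable {L : ℝ}

lemma exp_neg_one_le_capConst_mul_sqrt (hL : 1 ≤ L) (hd : 1 ≤ d) :
    Real.exp (-1) ≤ capConst d * √(1 - Real.exp (-(2 * L / d))) := by
  have hd0 : 0 < d := one_pos.trans_le hd
  set t := 2 * L / d with ht
  have : 0 < t := by positivity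
  have hexp : Real.exp (-t) ≤ (1 + t)⁻¹ := by
    rw [Real.exp_neg]
    gcongr
    linarith [Real.add_one_le_exp t]
  have hquarter : (1 / 2) ^ 2 ≤ d * (1 - (1 + t)⁻¹) := by
    have hval : d * (1 - (1 + t)⁻¹) = 2 * L * d / (d + 2 * L) := by
      rw [ht]
      field_simp
      ring
    rw [hval, le_div_iff₀ (by positivity)]
    nlinarith
  calc Real.exp (-1) ≤ 1 / 2 := by
        rw [Real.exp_neg, one_div]
        gcongr
        linarith [Real.add_one_le_exp 1]
    _ ≤ √(d * (1 - (1 + t)⁻¹)) := Real.le_sqrt_of_sq_le hquarter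
    _ = √d * √(1 - (1 + t)⁻¹) := Real.sqrt_mul hd0.le _
    _ ≤ capConst d * √(1 - Real.exp (-t)) := by
        gcongr
        · exact (capConst_pos hd0).le
        · exact sqrt_le_capConst hd0

lemma capConst_mul_sqrt_le (L : ℝ) (hd : 1 ≤ d) :
    capConst d * √(1 - Real.exp (-(2 * L / d))) ≤ 2 * √(2 * L) := by
  have hd0 : 0 < d := one_pos.trans_le hd
  calc capConst d * √(1 - Real.exp (-(2 * L / d))) ≤ 2 * √d * √(2 * L / d) := by
        gcongr
        · exact capConst_le hd
        · linarith [Real.add_one_le_exp (-(2 * L / d))]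
    _ = 2 * √(2 * L) := by
        rw [mul_assoc, ← Real.sqrt_mul hd0.le, mul_div_cancel₀ _ hd0.ne']

end CapConst

section Threshold

/-- The factor `p^{-2/(n-1)}` of `a_{p,n}` and `b_{p,n}`: the order of magnitude of `1 - M_{p,n}²`,
i.e. of the smallest squared sine of the angles between `p` uniform directions and a fixed one. -/
noncomputable def sinSqScale (p n : ℕ) : ℝ := (p : ℝ) ^ (-2 / ((n : ℝ) - 1))

/-- The threshold `1 - (a_{p,n} + b_{p,n} x)` for the squared sine `1 - M_{p,n}²`, replaced by `0`
when it is negative. -/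
noncomputable def sinSqThreshold (p n : ℕ) (x : ℝ) : ℝ :=
  sinSqScale p n * (cConst p n * max 0 (1 - 2 / ((n : ℝ) - 1) * x))

/-- The exponent `(1 - 2x/(n-1))₊^{(n-1)/2} = -log (G_n(x))` of the limiting distribution function:
the limiting mean number of squared sines below `sinSqThreshold p n x`. -/
noncomputable def limitExponent (n : ℕ) (x : ℝ) : ℝ :=
  max 0 (1 - 2 / ((n : ℝ) - 1) * x) ^ (((n : ℝ) - 1) / 2)

/-- The rate, in terms of `L = log p`, at which `sinSqThreshold p n x` and `sinSqScale p n` become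
close relative to `1 - sinSqScale p n`, uniformly in `n`. -/
noncomputable def thresholdRate (L x : ℝ) : ℝ := (|Real.log (2 * √(2 * L)) - x| + (1 + |x|)) / L

variable {p n : ℕ}

lemma one_le_natCast_sub_one (hn : 2 ≤ n) : 1 ≤ (n : ℝ) - 1 := by
  have : (2 : ℝ) ≤ n := mod_cast hn
  linarith

lemma limitExponent_nonneg (n : ℕ) (x : ℝ) : 0 ≤ limitExponent n x :=
  Real.rpow_nonneg (le_max_left _ _) _

lemma max_zero_one_sub_le_exp_neg (u : ℝ) : max 0 (1 - u) ≤ Real.exp (-u) :=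
  max_le (Real.exp_nonneg _) (Real.one_sub_le_exp_neg u)

lemma limitExponent_le_exp_neg (hn : 2 ≤ n) (x : ℝ) : limitExponent n x ≤ Real.exp (-x) := by
  have hd := one_pos.trans_le (one_le_natCast_sub_one hn)
  calc limitExponent n x ≤ Real.exp (-(2 / ((n : ℝ) - 1) * x)) ^ (((n : ℝ) - 1) / 2) := by
        unfold limitExponent
        gcongr
        exact max_zero_one_sub_le_exp_neg _
    _ = Real.exp (-x) := by
        rw [← Real.exp_mul]
        congr 1
        field_simp

lemma limitDF_eq_exp (hn : 2 ≤ n) (x : ℝ) : limitDF n x = Real.exp (-limitExponent n x) := by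
  have hd := one_pos.trans_le (one_le_natCast_sub_one hn)
  have hiff : x ≤ ((n : ℝ) - 1) / 2 ↔ 0 ≤ 1 - 2 / ((n : ℝ) - 1) * x := by
    rw [sub_nonneg, div_mul_eq_mul_div, div_le_one hd, le_div_iff₀ two_pos, mul_comm]
  unfold limitDF limitExponent
  split_ifs with h
  · rw [max_eq_right (hiff.1 h)]
  · rw [max_eq_left (not_le.1 (mt hiff.2 h)).le, Real.zero_rpow (by positivity), neg_zero,
      Real.exp_zero]

lemma tendsto_limitDF (x : ℝ) :
    Tendsto (fun n : ℕ => limitDF n x) atTop (𝓝 (Real.exp (-Real.exp (-x)))) := by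
  have hhalf : Tendsto (fun n : ℕ => ((n : ℝ) - 1) / 2) atTop atTop :=
    (tendsto_atTop_add_const_right _ (-1) tendsto_natCast_atTop_atTop).atTop_div_const two_pos
  have hpow := (Real.tendsto_one_add_div_rpow_exp (-x)).comp hhalf
  refine ((Real.continuous_exp.tendsto _).comp hpow.neg).congr' ?_
  filter_upwards [hhalf.eventually_ge_atTop x] with n hx
  have hbase : 1 + -x / (((n : ℝ) - 1) / 2) = 1 - 2 / ((n : ℝ) - 1) * x := by
    rw [neg_div, ← sub_eq_add_neg, div_div_eq_mul_div, mul_comm x, div_mul_eq_mul_div]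
  simp only [limitDF, if_pos hx, Function.comp_apply, hbase]

lemma sinSqScale_eq_exp (hp : p ≠ 0) (n : ℕ) :
    sinSqScale p n = Real.exp (-(2 * Real.log p / ((n : ℝ) - 1))) := by
  rw [sinSqScale, Real.rpow_def_of_pos (by positivity)]
  congr 1
  ring

lemma sinSqScale_pos (hp : p ≠ 0) (n : ℕ) : 0 < sinSqScale p n := by
  unfold sinSqScale
  positivity

lemma sinSqScale_lt_one (hp : 1 < p) (hn : 2 ≤ n) : sinSqScale p n < 1 := by
  have hd := one_pos.trans_le (one_le_natCast_sub_one hn)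
  have hlog := Real.log_pos (Nat.one_lt_cast (α := ℝ).2 hp)
  rw [sinSqScale_eq_exp (by positivity), Real.exp_lt_one_iff, neg_lt_zero]
  positivity

lemma cConst_eq (p n : ℕ) :
    cConst p n = (capConst ((n : ℝ) - 1) * √(1 - sinSqScale p n)) ^ (2 / ((n : ℝ) - 1)) := rfl

lemma cConst_pos (hp : 1 < p) (hn : 2 ≤ n) : 0 < cConst p n := by
  have hcap := capConst_pos (one_pos.trans_le (one_le_natCast_sub_one hn))
  have hsqrt := Real.sqrt_pos.2 (sub_pos.2 (sinSqScale_lt_one hp hn))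
  rw [cConst_eq]
  positivity

lemma bConst_pos (hp : 1 < p) (hn : 2 ≤ n) : 0 < bConst p n := by
  have hd := one_pos.trans_le (one_le_natCast_sub_one hn)
  have hc := cConst_pos hp hn
  unfold bConst
  positivity

lemma sinSqThreshold_nonneg (hp : 1 < p) (hn : 2 ≤ n) (x : ℝ) : 0 ≤ sinSqThreshold p n x :=
  mul_nonneg (sinSqScale_pos (by positivity) n).le
    (mul_nonneg (cConst_pos hp hn).le (le_max_left _ _))

lemma exp_neg_le_cConst (hp : 1 ≤ Real.log p) (hn : 2 ≤ n) :
    Real.exp (-(2 / ((n : ℝ) - 1))) ≤ cConst p n := by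
  have hd := one_le_natCast_sub_one hn
  have hp0 : p ≠ 0 := by rintro rfl; norm_num at hp
  rw [cConst_eq, sinSqScale_eq_exp hp0, ← neg_one_mul, Real.exp_mul]
  gcongr
  exact exp_neg_one_le_capConst_mul_sqrt hp hd

lemma cConst_le_exp (hp : 1 ≤ Real.log p) (hn : 2 ≤ n) :
    cConst p n ≤ Real.exp (2 / ((n : ℝ) - 1) * Real.log (2 * √(2 * Real.log p))) := by
  have hd := one_le_natCast_sub_one hn
  have hp0 : p ≠ 0 := by rintro rfl; norm_num at hp
  have hcap := capConst_pos (one_pos.trans_le hd)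
  rw [cConst_eq, sinSqScale_eq_exp hp0, mul_comm (2 / ((n : ℝ) - 1)), Real.exp_mul,
    Real.exp_log (by positivity)]
  exact Real.rpow_le_rpow (by positivity) (capConst_mul_sqrt_le _ hd) (by positivity)

-- By convexity, an error `ε t` in an exponent is small relative to `exp t - 1` even when `t` is
-- small. With `t = 2 log p / (n - 1)` this is what makes the estimates uniform in `n`.
lemma exp_mul_sub_one_le {ε t : ℝ} (h0 : 0 ≤ ε) (h1 : ε ≤ 1) :
    Real.exp (t * ε) - 1 ≤ ε * (Real.exp t - 1) := by
  have h := convexOn_exp.2 (Set.mem_univ t) (Set.mem_univ 0) h0 (sub_nonneg.2 h1) (by ring)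
  simp only [smul_eq_mul, mul_zero, add_zero, Real.exp_zero, mul_one] at h
  rw [mul_comm t]
  linarith

variable {x : ℝ}

lemma cConst_mul_max_sub_one_le (hp : 1 ≤ Real.log p) (hn : 2 ≤ n)
    (hrate : thresholdRate (Real.log p) x ≤ 1) :
    cConst p n * max 0 (1 - 2 / ((n : ℝ) - 1) * x) - 1 ≤
      thresholdRate (Real.log p) x * (Real.exp (2 * Real.log p / ((n : ℝ) - 1)) - 1) := by
  have hd := one_pos.trans_le (one_le_natCast_sub_one hn)
  set d := (n : ℝ) - 1
  set L := Real.log p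
  set g := Real.log (2 * √(2 * L)) - x with hg
  have : 0 < L := one_pos.trans_le hp
  have hgrate : |g| / L ≤ thresholdRate L x := by
    unfold thresholdRate
    gcongr
    linarith [abs_nonneg x]
  have hexp : 0 ≤ Real.exp (2 * L / d) - 1 :=
    sub_nonneg.2 (Real.one_le_exp (by positivity))
  calc cConst p n * max 0 (1 - 2 / d * x) - 1
      ≤ Real.exp (2 / d * Real.log (2 * √(2 * L))) * Real.exp (-(2 / d * x)) - 1 := by
        gcongr
        · exact cConst_le_exp hp hn
        · exact max_zero_one_sub_le_exp_neg _
    _ = Real.exp (2 * L / d * (g / L)) - 1 := by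
        rw [← Real.exp_add, hg]
        congr 2
        field_simp
        ring
    _ ≤ Real.exp (2 * L / d * (|g| / L)) - 1 := by
        gcongr
        exact le_abs_self g
    _ ≤ |g| / L * (Real.exp (2 * L / d) - 1) :=
        exp_mul_sub_one_le (by positivity) (hgrate.trans hrate)
    _ ≤ thresholdRate L x * (Real.exp (2 * L / d) - 1) := by gcongr

lemma one_sub_cConst_mul_max_le (hp : 1 ≤ Real.log p) (hn : 2 ≤ n) :
    1 - cConst p n * max 0 (1 - 2 / ((n : ℝ) - 1) * x) ≤
      thresholdRate (Real.log p) x * (Real.exp (2 * Real.log p / ((n : ℝ) - 1)) - 1) := by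
  have hd := one_pos.trans_le (one_le_natCast_sub_one hn)
  have hc := exp_neg_le_cConst hp hn
  set d := (n : ℝ) - 1
  set L := Real.log p
  have hL : 0 < L := one_pos.trans_le hp
  have hmax : 1 - 2 / d * |x| ≤ max 0 (1 - 2 / d * x) := by
    refine le_max_of_le_right ?_
    gcongr
    exact le_abs_self x
  have hexp_le : Real.exp (-(2 / d)) ≤ 1 := Real.exp_le_one_iff.2 (neg_nonpos.2 (by positivity))
  have hexp_ge : 1 - 2 / d ≤ Real.exp (-(2 / d)) := Real.one_sub_le_exp_neg _
  have hx : 0 ≤ 2 / d * |x| := by positivity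
  have hprod : Real.exp (-(2 / d)) * (1 - 2 / d * |x|) ≤ cConst p n * max 0 (1 - 2 / d * x) :=
    (mul_le_mul_of_nonneg_left hmax (Real.exp_nonneg _)).trans
      (mul_le_mul_of_nonneg_right hc (le_max_left _ _))
  calc 1 - cConst p n * max 0 (1 - 2 / d * x) ≤ 2 / d * (1 + |x|) := by nlinarith
    _ = (1 + |x|) / L * (2 * L / d) := by field_simp
    _ ≤ thresholdRate L x * (Real.exp (2 * L / d) - 1) := by
        have hadd : 2 * L / d ≤ Real.exp (2 * L / d) - 1 :=
          le_sub_iff_add_le.2 (Real.add_one_le_exp _)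
        have hrate : (1 + |x|) / L ≤ thresholdRate L x :=
          div_le_div_of_nonneg_right (le_add_of_nonneg_left (abs_nonneg _)) hL.le
        gcongr
        exact (by positivity : 0 ≤ (1 + |x|) / L).trans hrate

lemma abs_sinSqThreshold_sub_sinSqScale_le (hp : 1 ≤ Real.log p) (hn : 2 ≤ n)
    (hrate : thresholdRate (Real.log p) x ≤ 1) :
    |sinSqThreshold p n x - sinSqScale p n| ≤
      thresholdRate (Real.log p) x * (1 - sinSqScale p n) := by
  have hp0 : p ≠ 0 := by rintro rfl; norm_num at hp
  have hq := sinSqScale_pos hp0 n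
  have hone_sub : 1 - sinSqScale p n =
      sinSqScale p n * (Real.exp (2 * Real.log p / ((n : ℝ) - 1)) - 1) := by
    rw [sinSqScale_eq_exp hp0, mul_sub, ← Real.exp_add, neg_add_cancel, Real.exp_zero, mul_one]
  rw [hone_sub, sinSqThreshold, ← mul_sub_one, abs_mul, abs_of_pos hq, mul_left_comm]
  gcongr
  exact abs_sub_le_iff.2
    ⟨cConst_mul_max_sub_one_le hp hn hrate, one_sub_cConst_mul_max_le hp hn⟩

lemma tendsto_thresholdRate (x : ℝ) : Tendsto (fun L => thresholdRate L x) atTop (𝓝 0) := by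
  have hlog : (fun L : ℝ => Real.log (2 * √(2 * L))) =o[atTop] (fun L => L) := by
    have hconst : (fun _ : ℝ => Real.log 2 + Real.log 2 / 2) =o[atTop] (fun L : ℝ => L) :=
      Asymptotics.isLittleO_const_id_atTop _
    refine (hconst.add (Real.isLittleO_log_id_atTop.const_mul_left (1 / 2))).congr' ?_ .rfl
    filter_upwards [eventually_gt_atTop 0] with L hL
    rw [Real.log_mul two_ne_zero (by positivity), Real.log_sqrt (by positivity),
      Real.log_mul two_ne_zero hL.ne']
    ring
  exact ((hlog.sub (Asymptotics.isLittleO_const_id_atTop x)).norm_left.add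
    (Asymptotics.isLittleO_const_id_atTop (1 + |x|))).tendsto_div_nhds_zero

end Threshold

section TailAsymptotics

/-- `P(B ≥ 1 - sinSqThreshold p n x)` for `B` with the Beta distribution of parameters `1/2` and
`(n-1)/2`, the law of the squares whose maximum is `M_{p,n}²`. -/
noncomputable def cosSqTail (p n : ℕ) (x : ℝ) : ℝ :=
  (betaMeasure (1 / 2) (((n : ℝ) - 1) / 2)).real (Set.Ici (1 - sinSqThreshold p n x))

/-- The square root relating, to leading order, `p * cosSqTail p n x` and `limitExponent n x`. -/
noncomputable def sineRatio (p n : ℕ) (x : ℝ) : ℝ :=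
  √((1 - sinSqScale p n) / (1 - sinSqThreshold p n x))

variable {p n : ℕ} {x : ℝ}

lemma aConst_add_bConst_mul (p n : ℕ) (x : ℝ) :
    aConst p n + bConst p n * x
      = 1 - sinSqScale p n * (cConst p n * (1 - 2 / ((n : ℝ) - 1) * x)) := by
  rw [aConst, bConst, sinSqScale]
  ring

lemma betaMeasure_real_Ici_one {a b : ℝ} (ha0 : 0 < a) (ha1 : a ≤ 1) (hb : 0 < b) :
    (betaMeasure a b).real (Set.Ici 1) = 0 := by
  have h := mul_betaMeasure_real_Ici_le ha0 ha1 hb le_rfl one_pos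
  rw [Real.zero_rpow hb.ne', zero_mul, sub_zero] at h
  have := beta_pos ha0 hb
  exact le_antisymm (nonpos_of_mul_nonpos_right h (by positivity)) measureReal_nonneg

lemma betaMeasure_real_Iio_eq (hp : 1 < p) (hn : 2 ≤ n) (x : ℝ) :
    (betaMeasure (1 / 2) (((n : ℝ) - 1) / 2)).real (Set.Iio (aConst p n + bConst p n * x))
      = 1 - cosSqTail p n x := by
  have hd := one_pos.trans_le (one_le_natCast_sub_one hn)
  have := isProbabilityMeasureBeta one_half_pos (half_pos hd)
  rw [← Set.compl_Ici, probReal_compl_eq_one_sub measurableSet_Ici, cosSqTail,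
    aConst_add_bConst_mul, sinSqThreshold]
  rcases le_total 0 (1 - 2 / ((n : ℝ) - 1) * x) with h | h
  · rw [max_eq_right h]
  · have hone := betaMeasure_real_Ici_one one_half_pos one_half_lt_one.le (half_pos hd)
    have hneg : sinSqScale p n * (cConst p n * (1 - 2 / ((n : ℝ) - 1) * x)) ≤ 0 :=
      mul_nonpos_of_nonneg_of_nonpos (sinSqScale_pos (by positivity) n).le
        (mul_nonpos_of_nonneg_of_nonpos (cConst_pos hp hn).le h)
    rw [max_eq_left h, mul_zero, mul_zero, sub_zero, hone,
      measureReal_mono_null (Set.Ici_subset_Ici.2 (by linarith)) hone]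

lemma mul_sinSqThreshold_rpow (hp : 1 < p) (hn : 2 ≤ n) (x : ℝ) :
    p * sinSqThreshold p n x ^ (((n : ℝ) - 1) / 2)
      = capConst ((n : ℝ) - 1) * √(1 - sinSqScale p n) * limitExponent n x := by
  have hd := one_pos.trans_le (one_le_natCast_sub_one hn)
  have hcap := capConst_pos hd
  have hq := sinSqScale_pos (by positivity : p ≠ 0) n
  have hc := cConst_pos hp hn
  have hscale : sinSqScale p n ^ (((n : ℝ) - 1) / 2) = (p : ℝ)⁻¹ := by
    rw [sinSqScale, ← Real.rpow_mul (by positivity), ← Real.rpow_neg_one]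
    congr 1
    field_simp
  have hcap_rpow : cConst p n ^ (((n : ℝ) - 1) / 2)
      = capConst ((n : ℝ) - 1) * √(1 - sinSqScale p n) := by
    rw [cConst_eq, ← Real.rpow_mul (by positivity)]
    convert Real.rpow_one _ using 2
    field_simp
  rw [sinSqThreshold, limitExponent, Real.mul_rpow hq.le (by positivity),
    Real.mul_rpow hc.le (le_max_left _ _), hscale, hcap_rpow,
    mul_inv_cancel_left₀ (by positivity)]

lemma mul_sinSqThreshold_rpow_mul_one_sub_rpow (hp : 1 < p) (hn : 2 ≤ n)
    (hr : sinSqThreshold p n x < 1) :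
    p * (sinSqThreshold p n x ^ (((n : ℝ) - 1) / 2)
        * (1 - sinSqThreshold p n x) ^ ((1 : ℝ) / 2 - 1))
      = capConst ((n : ℝ) - 1) * (limitExponent n x * sineRatio p n x) := by
  have hhalf : (1 : ℝ) / 2 - 1 = -(1 / 2) := by norm_num
  rw [← mul_assoc, mul_sinSqThreshold_rpow hp hn, sineRatio,
    Real.sqrt_div (sub_pos.2 (sinSqScale_lt_one hp hn)).le, hhalf, Real.rpow_neg (sub_pos.2 hr).le,
    ← Real.sqrt_eq_rpow]
  ring

lemma mul_cosSqTail_le (hp : 1 < p) (hn : 2 ≤ n) (hr : sinSqThreshold p n x < 1) :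
    p * cosSqTail p n x ≤ limitExponent n x * sineRatio p n x := by
  have hd := one_pos.trans_le (one_le_natCast_sub_one hn)
  refine le_of_mul_le_mul_left ?_ (capConst_pos hd)
  rw [← mul_sinSqThreshold_rpow_mul_one_sub_rpow hp hn hr, mul_left_comm]
  exact mul_le_mul_of_nonneg_left (mul_betaMeasure_real_Ici_le one_half_pos one_half_lt_one.le
    (half_pos hd) (sinSqThreshold_nonneg hp hn x) hr) (Nat.cast_nonneg p)

lemma limitExponent_mul_sineRatio_le (hp : 1 < p) (hn : 2 ≤ n) (hr : sinSqThreshold p n x < 1) :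
    limitExponent n x * sineRatio p n x
      ≤ (1 + sinSqThreshold p n x / (((n : ℝ) - 1) * (1 - sinSqThreshold p n x)))
        * (p * cosSqTail p n x) := by
  have hd := one_pos.trans_le (one_le_natCast_sub_one hn)
  have h1r := sub_pos.2 hr
  refine le_of_mul_le_mul_left ?_ (capConst_pos hd)
  rw [← mul_sinSqThreshold_rpow_mul_one_sub_rpow hp hn hr]
  calc _ ≤ p * ((((n : ℝ) - 1) / 2 + (1 - 1 / 2) *
          (sinSqThreshold p n x / (1 - sinSqThreshold p n x))) *
          (beta (1 / 2) (((n : ℝ) - 1) / 2) * cosSqTail p n x)) :=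
        mul_le_mul_of_nonneg_left (le_mul_betaMeasure_real_Ici one_half_pos one_half_lt_one.le
          (half_pos hd) (sinSqThreshold_nonneg hp hn x) hr) (Nat.cast_nonneg p)
    _ = _ := by
        rw [capConst]
        field_simp
        ring

lemma abs_one_sub_pow_sub_exp_le (p : ℕ) {s : ℝ} (h0 : 0 ≤ s) (h1 : s ≤ 1) :
    |(1 - s) ^ p - Real.exp (-(p * s))| ≤ p * s ^ 2 := by
  have hlower : 1 - s ≤ Real.exp (-s) := Real.one_sub_le_exp_neg s
  have hupper : Real.exp (-s) ≤ 1 - s + s ^ 2 := by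
    have h := Real.abs_exp_sub_one_sub_id_le (x := -s) (by rwa [abs_neg, abs_of_nonneg h0])
    linarith [(abs_le.1 h).2, neg_sq s]
  have hmax : max |1 - s| |Real.exp (-s)| ≤ 1 := by
    rw [abs_of_nonneg (sub_nonneg.2 h1), Real.abs_exp]
    exact max_le (sub_le_self _ h0) (Real.exp_le_one_iff.2 (neg_nonpos.2 h0))
  have habs : |1 - s - Real.exp (-s)| ≤ s ^ 2 := abs_le.2 ⟨by linarith, by linarith [sq_nonneg s]⟩
  calc |(1 - s) ^ p - Real.exp (-(p * s))|
      = |(1 - s) ^ p - Real.exp (-s) ^ p| := by rw [← Real.exp_nat_mul, mul_neg]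
    _ ≤ |1 - s - Real.exp (-s)| * p * max |1 - s| |Real.exp (-s)| ^ (p - 1) :=
        abs_pow_sub_pow_le _ _ p
    _ ≤ s ^ 2 * p * 1 := by
        gcongr
        exact pow_le_one₀ (le_max_of_le_left (abs_nonneg _)) hmax
    _ = p * s ^ 2 := by ring

lemma abs_exp_neg_sub_exp_neg_le {s t : ℝ} (hs : 0 ≤ s) (ht : 0 ≤ t) :
    |Real.exp (-s) - Real.exp (-t)| ≤ |s - t| := by
  wlog h : s ≤ t generalizing s t
  · rw [abs_sub_comm, abs_sub_comm s]
    exact this ht hs (le_of_not_ge h)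
  have hle : Real.exp (-t) ≤ Real.exp (-s) := Real.exp_le_exp.2 (neg_le_neg h)
  have hfactor : Real.exp (-t) = Real.exp (-s) * Real.exp (-(t - s)) := by
    rw [← Real.exp_add]
    ring_nf
  have hone : Real.exp (-s) ≤ 1 := Real.exp_le_one_iff.2 (neg_nonpos.2 hs)
  have hlin := Real.one_sub_le_exp_neg (t - s)
  rw [abs_of_nonneg (sub_nonneg.2 hle), abs_sub_comm, abs_of_nonneg (sub_nonneg.2 h), hfactor]
  nlinarith [Real.exp_pos (-s)]

end TailAsymptotics

section UniformLimit

lemma tendsto_log_fst (k : ℕ) : Tendsto (fun q : ℕ × ℕ => Real.log q.1)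
    (atTop ×ˢ 𝓟 (Set.Ici k)) atTop :=
  Real.tendsto_log_atTop.comp (tendsto_natCast_atTop_atTop.comp tendsto_fst)

lemma eventually_one_lt_fst_and_two_le_snd :
    ∀ᶠ q : ℕ × ℕ in atTop ×ˢ 𝓟 (Set.Ici 2), 1 < q.1 ∧ 2 ≤ q.2 :=
  (eventually_gt_atTop 1).prod_mk (mem_principal_self (Set.Ici 2))

lemma tendsto_sinSqThreshold_sub_div (x : ℝ) :
    Tendsto (fun q : ℕ × ℕ =>
        (sinSqThreshold q.1 q.2 x - sinSqScale q.1 q.2) / (1 - sinSqScale q.1 q.2))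
      (atTop ×ˢ 𝓟 (Set.Ici 2)) (𝓝 0) := by
  have hrate := (tendsto_thresholdRate x).comp (tendsto_log_fst 2)
  refine squeeze_zero_norm' ?_ hrate
  filter_upwards [eventually_one_lt_fst_and_two_le_snd, (tendsto_log_fst 2).eventually_ge_atTop 1,
    hrate.eventually_le_const one_pos] with q ⟨hp, hn⟩ hlog hle
  have hscale := sub_pos.2 (sinSqScale_lt_one hp hn)
  rw [Real.norm_eq_abs, abs_div, abs_of_pos hscale, div_le_iff₀ hscale]
  exact abs_sinSqThreshold_sub_sinSqScale_le hlog hn hle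

lemma one_sub_sinSqThreshold_eq {p n : ℕ} (hp : 1 < p) (hn : 2 ≤ n) (x : ℝ) :
    1 - sinSqThreshold p n x = (1 - sinSqScale p n) *
      (1 - (sinSqThreshold p n x - sinSqScale p n) / (1 - sinSqScale p n)) := by
  rw [mul_one_sub, mul_div_cancel₀ _ (sub_pos.2 (sinSqScale_lt_one hp hn)).ne']
  ring

lemma eventually_sinSqThreshold_lt_one (x : ℝ) :
    ∀ᶠ q : ℕ × ℕ in atTop ×ˢ 𝓟 (Set.Ici 2), sinSqThreshold q.1 q.2 x < 1 := by
  filter_upwards [eventually_one_lt_fst_and_two_le_snd,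
    (tendsto_sinSqThreshold_sub_div x).eventually_lt_const one_pos] with q ⟨hp, hn⟩ herr
  rw [← sub_pos, one_sub_sinSqThreshold_eq hp hn]
  exact mul_pos (sub_pos.2 (sinSqScale_lt_one hp hn)) (sub_pos.2 herr)

lemma tendsto_one_sub_sinSqScale_div (x : ℝ) :
    Tendsto (fun q : ℕ × ℕ => (1 - sinSqScale q.1 q.2) / (1 - sinSqThreshold q.1 q.2 x))
      (atTop ×ˢ 𝓟 (Set.Ici 2)) (𝓝 1) := by
  have hinv := ((tendsto_sinSqThreshold_sub_div x).const_sub 1).inv₀ (by simp)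
  rw [sub_zero, inv_one] at hinv
  refine hinv.congr' ?_
  filter_upwards [eventually_one_lt_fst_and_two_le_snd] with q ⟨hp, hn⟩
  rw [one_sub_sinSqThreshold_eq hp hn,
    div_mul_cancel_left₀ (sub_pos.2 (sinSqScale_lt_one hp hn)).ne']

lemma tendsto_sineRatio (x : ℝ) : Tendsto (fun q : ℕ × ℕ => sineRatio q.1 q.2 x)
    (atTop ×ˢ 𝓟 (Set.Ici 2)) (𝓝 1) := by
  simpa only [Real.sqrt_one, sineRatio] using (tendsto_one_sub_sinSqScale_div x).sqrt

lemma sinSqScale_div_le {p n : ℕ} (hp : 1 < p) (hn : 2 ≤ n) :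
    sinSqScale p n / (((n : ℝ) - 1) * (1 - sinSqScale p n)) ≤ (2 * Real.log p)⁻¹ := by
  have hd := one_pos.trans_le (one_le_natCast_sub_one hn)
  have hlog := Real.log_pos (Nat.one_lt_cast (α := ℝ).2 hp)
  have hq := sinSqScale_pos (by positivity : p ≠ 0) n
  have hscale := sub_pos.2 (sinSqScale_lt_one hp hn)
  have hexp : sinSqScale p n * (1 + 2 * Real.log p / ((n : ℝ) - 1)) ≤ 1 := by
    calc sinSqScale p n * (1 + 2 * Real.log p / ((n : ℝ) - 1))
        ≤ sinSqScale p n * Real.exp (2 * Real.log p / ((n : ℝ) - 1)) := by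
          gcongr
          linarith [Real.add_one_le_exp (2 * Real.log p / ((n : ℝ) - 1))]
      _ = 1 := by
          rw [sinSqScale_eq_exp (by positivity), ← Real.exp_add, neg_add_cancel, Real.exp_zero]
  have hmul : sinSqScale p n * (2 * Real.log p) ≤ ((n : ℝ) - 1) * (1 - sinSqScale p n) := by
    rw [← div_le_iff₀' hd, mul_div_assoc]
    linarith
  rw [inv_eq_one_div, div_le_div_iff₀ (by positivity) (by positivity), one_mul]
  exact hmul

lemma tendsto_sinSqThreshold_div (x : ℝ) :
    Tendsto (fun q : ℕ × ℕ =>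
        sinSqThreshold q.1 q.2 x / (((q.2 : ℝ) - 1) * (1 - sinSqThreshold q.1 q.2 x)))
      (atTop ×ˢ 𝓟 (Set.Ici 2)) (𝓝 0) := by
  have hbound := ((((tendsto_log_fst 2).const_mul_atTop two_pos).inv_tendsto_atTop).add
    (tendsto_sinSqThreshold_sub_div x).abs).mul (tendsto_one_sub_sinSqScale_div x)
  rw [abs_zero, add_zero, zero_mul] at hbound
  refine squeeze_zero' ?_ ?_ hbound
  all_goals
    filter_upwards [eventually_one_lt_fst_and_two_le_snd, eventually_sinSqThreshold_lt_one x]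
      with q ⟨hp, hn⟩ hlt
    have hd := one_le_natCast_sub_one hn
    have hd0 := one_pos.trans_le hd
    have hr := sub_pos.2 hlt
    have hscale := sub_pos.2 (sinSqScale_lt_one hp hn)
  · exact div_nonneg (sinSqThreshold_nonneg hp hn x) (by positivity)
  set r := sinSqThreshold q.1 q.2 x
  set s := sinSqScale q.1 q.2
  set d := (q.2 : ℝ) - 1
  calc r / (d * (1 - r)) = (s / (d * (1 - s)) + (r - s) / (1 - s) / d) * ((1 - s) / (1 - r)) := by
        field_simp
        ring
    _ ≤ ((2 * Real.log q.1)⁻¹ + |(r - s) / (1 - s)|) * ((1 - s) / (1 - r)) := by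
        gcongr
        · exact sinSqScale_div_le hp hn
        · rw [div_le_iff₀ hd0]
          exact (le_abs_self _).trans (le_mul_of_one_le_right (abs_nonneg _) hd)

lemma tendsto_mul_cosSqTail_sub_limitExponent (x : ℝ) :
    Tendsto (fun q : ℕ × ℕ => q.1 * cosSqTail q.1 q.2 x - limitExponent q.2 x)
      (atTop ×ˢ 𝓟 (Set.Ici 2)) (𝓝 0) := by
  have hratio := tendsto_sineRatio x
  have hbound := (((hratio.sub_const 1).abs).add
    ((tendsto_sinSqThreshold_div x).mul hratio)).const_mul (Real.exp (-x))
  rw [sub_self, abs_zero, zero_mul, add_zero, mul_zero] at hbound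
  refine squeeze_zero_norm' ?_ hbound
  filter_upwards [eventually_one_lt_fst_and_two_le_snd, eventually_sinSqThreshold_lt_one x]
    with q ⟨hp, hn⟩ hlt
  have hle := mul_cosSqTail_le hp hn hlt
  have hge := limitExponent_mul_sineRatio_le hp hn hlt
  have hy := limitExponent_nonneg q.2 x
  have herr : 0 ≤ sinSqThreshold q.1 q.2 x / (((q.2 : ℝ) - 1) * (1 - sinSqThreshold q.1 q.2 x)) :=
    div_nonneg (sinSqThreshold_nonneg hp hn x)
      (mul_nonneg (one_pos.trans_le (one_le_natCast_sub_one hn)).le (sub_pos.2 hlt).le)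
  have hu : 0 ≤ sineRatio q.1 q.2 x := Real.sqrt_nonneg _
  set e := sinSqThreshold q.1 q.2 x / (((q.2 : ℝ) - 1) * (1 - sinSqThreshold q.1 q.2 x))
  set u := sineRatio q.1 q.2 x
  set w := q.1 * cosSqTail q.1 q.2 x
  calc |w - limitExponent q.2 x| ≤ limitExponent q.2 x * (|u - 1| + e * u) := by
        have hew : e * w ≤ e * (limitExponent q.2 x * u) := mul_le_mul_of_nonneg_left hle herr
        have hu1 := mul_le_mul_of_nonneg_left (le_abs_self (u - 1)) hy
        have hu2 := mul_le_mul_of_nonneg_left (neg_abs_le (u - 1)) hy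
        have : 0 ≤ e * (limitExponent q.2 x * u) := by positivity
        rw [abs_le]
        constructor <;> linarith
    _ ≤ Real.exp (-x) * (|u - 1| + e * u) := by
        gcongr
        exact limitExponent_le_exp_neg hn x

lemma tendsto_mul_cosSqTail_sq (x : ℝ) :
    Tendsto (fun q : ℕ × ℕ => q.1 * cosSqTail q.1 q.2 x ^ 2) (atTop ×ˢ 𝓟 (Set.Ici 2)) (𝓝 0) := by
  have hinv : Tendsto (fun q : ℕ × ℕ => ((q.1 : ℝ))⁻¹) (atTop ×ˢ 𝓟 (Set.Ici 2)) (𝓝 0) :=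
    tendsto_inv_atTop_zero.comp (tendsto_natCast_atTop_atTop.comp tendsto_fst)
  have hbound := (((tendsto_mul_cosSqTail_sub_limitExponent x).abs.add_const
    (Real.exp (-x))).pow 2).mul hinv
  rw [mul_zero] at hbound
  refine squeeze_zero' (Eventually.of_forall fun q => by positivity) ?_ hbound
  filter_upwards [eventually_one_lt_fst_and_two_le_snd] with q ⟨hp, hn⟩
  have htail : 0 ≤ cosSqTail q.1 q.2 x := measureReal_nonneg
  have hle : q.1 * cosSqTail q.1 q.2 x
      ≤ |q.1 * cosSqTail q.1 q.2 x - limitExponent q.2 x| + Real.exp (-x) := by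
    linarith [le_abs_self (q.1 * cosSqTail q.1 q.2 x - limitExponent q.2 x),
      limitExponent_le_exp_neg hn x]
  calc q.1 * cosSqTail q.1 q.2 x ^ 2 = (q.1 * cosSqTail q.1 q.2 x) ^ 2 * (q.1 : ℝ)⁻¹ := by
        field_simp
    _ ≤ _ := by gcongr

theorem tendsto_betaMeasure_real_Iio_pow_sub_limitDF (x : ℝ) :
    Tendsto (fun q : ℕ × ℕ => (betaMeasure (1 / 2) (((q.2 : ℝ) - 1) / 2)).real
        (Set.Iio (aConst q.1 q.2 + bConst q.1 q.2 * x)) ^ q.1 - limitDF q.2 x)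
      (atTop ×ˢ 𝓟 (Set.Ici 2)) (𝓝 0) := by
  have hbound := (tendsto_mul_cosSqTail_sq x).add (tendsto_mul_cosSqTail_sub_limitExponent x).abs
  rw [abs_zero, add_zero] at hbound
  refine squeeze_zero_norm' ?_ hbound
  filter_upwards [eventually_one_lt_fst_and_two_le_snd] with q ⟨hp, hn⟩
  have := isProbabilityMeasureBeta one_half_pos
    (half_pos (one_pos.trans_le (one_le_natCast_sub_one hn)))
  have htail : 0 ≤ cosSqTail q.1 q.2 x := measureReal_nonneg
  rw [betaMeasure_real_Iio_eq hp hn, limitDF_eq_exp hn]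
  exact (abs_sub_le _ _ _).trans
    (add_le_add (abs_one_sub_pow_sub_exp_le q.1 htail measureReal_le_one)
      (abs_exp_neg_sub_exp_neg_le (by positivity) (limitExponent_nonneg q.2 x)))

end UniformLimit

section DoubleLimit

lemma tendsto_iSup_abs_of_prod_principal {α ι : Type*} {l : Filter α} {s : Set ι} {f : α × ι → ℝ}
    (hf : Tendsto f (l ×ˢ 𝓟 s) (𝓝 0)) : Tendsto (fun a => ⨆ i : s, |f (a, i)|) l (𝓝 0) := by
  refine Metric.tendsto_nhds.2 fun ε hε => ?_
  filter_upwards [eventually_prod_principal_iff.1 (Metric.tendsto_nhds.1 hf (ε / 2) (half_pos hε))]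
    with a ha
  simp only [Real.dist_0_eq_abs] at ha ⊢
  rw [abs_of_nonneg (Real.iSup_nonneg fun _ => abs_nonneg _)]
  exact (Real.iSup_le (fun i : s => (ha i i.2).le) (half_pos hε).le).trans_lt (half_lt_self hε)

lemma atTop_prod_atTop_le_prod_principal {α : Type*} (l : Filter α) (k : ℕ) :
    l ×ˢ atTop ≤ l ×ˢ 𝓟 (Set.Ici k) :=
  prod_mono_right l (le_principal_iff.2 (Ici_mem_atTop k))

lemma tendsto_of_tendsto_sub_comp_snd {α : Type*} {l : Filter α} {f : α × ℕ → ℝ} {g : ℕ → ℝ}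
    {c : ℝ} (hf : Tendsto (fun q => f q - g q.2) (l ×ˢ atTop) (𝓝 0)) (hg : Tendsto g atTop (𝓝 c)) :
    Tendsto f (l ×ˢ atTop) (𝓝 c) := by
  simpa only [Function.comp_apply, sub_add_cancel, zero_add] using hf.add (hg.comp tendsto_snd)

lemma tendsto_measureReal_sub_of_cond {α : Type*} {l : Filter α} {Ω : α → Type*}
    [∀ a, MeasurableSpace (Ω a)] {μ : ∀ a, Measure (Ω a)} [∀ a, IsProbabilityMeasure (μ a)]
    {D S : ∀ a, Set (Ω a)} {g : α → ℝ} (hD : ∀ᶠ a in l, NullMeasurableSet (D a) (μ a))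
    (hlim : Tendsto (fun a => (μ a).real (D a)) l (𝓝 1))
    (hcond : Tendsto (fun a => (ProbabilityTheory.cond (μ a) (D a)).real (S a) - g a) l (𝓝 0)) :
    Tendsto (fun a => (μ a).real (S a) - g a) l (𝓝 0) := by
  have hdiff : Tendsto
      (fun a => (μ a).real (S a) - (ProbabilityTheory.cond (μ a) (D a)).real (S a)) l (𝓝 0) := by
    refine squeeze_zero_norm' (hD.mono fun a ha => abs_measureReal_sub_cond_real_le ha (S a)) ?_
    simpa only [sub_self] using hlim.const_sub 1
  simpa only [sub_add_sub_cancel, zero_add] using hdiff.add hcond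

end DoubleLimit

section Normalized

lemma setOf_sub_div_lt_eq {Ω : Type*} {a b : ℝ} (hb : 0 < b) (f : Ω → ℝ) (x : ℝ) :
    {ω | (f ω - a) / b < x} = {ω | f ω < a + b * x} := by
  ext ω
  rw [Set.mem_ofPred_eq, Set.mem_ofPred_eq, div_lt_iff₀' hb, sub_lt_iff_lt_add']

variable {Ω : ℕ → ℕ → Type u} [∀ p n, MeasurableSpace (Ω p n)] {μ : ∀ p n, Measure (Ω p n)}
  [∀ p n, IsProbabilityMeasure (μ p n)]

theorem tendsto_measureReal_maxInner_sub_limitDF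
    {L : ∀ p n, Fin p → Ω p n → EuclideanSpace ℝ (Fin n)}
    {U : ∀ p n, Ω p n → EuclideanSpace ℝ (Fin n)}
    (h : ∀ p n, 2 ≤ n → IsSphereSample (L p n) (U p n) (μ p n)) (x : ℝ) :
    Tendsto (fun q : ℕ × ℕ => (μ q.1 q.2).real
        {ω | (maxInner (L q.1 q.2) (U q.1 q.2) ω ^ 2 - aConst q.1 q.2) / bConst q.1 q.2 < x}
        - limitDF q.2 x)
      (atTop ×ˢ 𝓟 (Set.Ici 2)) (𝓝 0) := by
  refine (tendsto_betaMeasure_real_Iio_pow_sub_limitDF x).congr' ?_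
  filter_upwards [eventually_one_lt_fst_and_two_le_snd] with q ⟨hp, hn⟩
  rw [setOf_sub_div_lt_eq (bConst_pos hp hn),
    (h q.1 q.2 hn).measureReal_maxInner_sq_lt (by positivity) hn]

variable {X : ∀ p n, Fin n → Fin p → Ω p n → ℝ} {Y : ∀ p n, Fin n → Ω p n → ℝ}

theorem tendsto_cond_real_maxCorr_sub_limitDF
    (h : ∀ p n, 3 ≤ n → IsGaussianDesign (X p n) (Y p n) (μ p n))
    (hY : ∀ p n, 3 ≤ n → μ p n (nonconst (Y p n)) ≠ 0) (x : ℝ) :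
    Tendsto (fun q : ℕ × ℕ => (ProbabilityTheory.cond (μ q.1 q.2) (nonconst (Y q.1 q.2))).real
        {ω | (maxCorr (X q.1 q.2) (Y q.1 q.2) ω ^ 2 - aConst q.1 (q.2 - 1))
          / bConst q.1 (q.2 - 1) < x}
        - limitDF (q.2 - 1) x)
      (atTop ×ˢ 𝓟 (Set.Ici 3)) (𝓝 0) := by
  have hpred : Tendsto (fun n : ℕ => n - 1) (𝓟 (Set.Ici 3)) (𝓟 (Set.Ici 2)) :=
    tendsto_principal_principal.2 fun n hn => Nat.le_sub_one_of_lt hn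
  have hshift := (tendsto_id (x := (atTop : Filter ℕ))).prodMap hpred
  refine ((tendsto_betaMeasure_real_Iio_pow_sub_limitDF x).comp hshift).congr' ?_
  filter_upwards [hshift.eventually eventually_one_lt_fst_and_two_le_snd,
    tendsto_snd.eventually (mem_principal_self (Set.Ici 3))] with q ⟨hp, hn2⟩ hn
  have hcast : ((q.2 - 1 : ℕ) : ℝ) - 1 = q.2 - 2 := by
    rw [Nat.cast_pred (two_pos.trans (Nat.lt_of_succ_le hn))]
    ring
  simp only [Function.comp_apply, Prod.map_fst, Prod.map_snd, id_eq] at hp hn2 ⊢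
  rw [setOf_sub_div_lt_eq (bConst_pos hp hn2),
    (h q.1 q.2 hn).cond_real_maxCorr_sq_lt (by positivity) hn (hY q.1 q.2 hn), hcast]

theorem tendsto_measureReal_maxCorr_sub_limitDF
    (h : ∀ p n, 3 ≤ n → IsGaussianDesign (X p n) (Y p n) (μ p n))
    (hY : ∀ p n, 3 ≤ n → μ p n (nonconst (Y p n)) ≠ 0) (x : ℝ) {l : Filter (ℕ × ℕ)}
    (hl : l ≤ atTop ×ˢ 𝓟 (Set.Ici 3))
    (hD : Tendsto (fun q : ℕ × ℕ => (μ q.1 q.2).real (nonconst (Y q.1 q.2))) l (𝓝 1)) :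
    Tendsto (fun q : ℕ × ℕ => (μ q.1 q.2).real
        {ω | (maxCorr (X q.1 q.2) (Y q.1 q.2) ω ^ 2 - aConst q.1 (q.2 - 1))
          / bConst q.1 (q.2 - 1) < x}
        - limitDF (q.2 - 1) x) l (𝓝 0) := by
  have hmeas : ∀ᶠ q : ℕ × ℕ in l, NullMeasurableSet (nonconst (Y q.1 q.2)) (μ q.1 q.2) := by
    filter_upwards [hl (tendsto_snd.eventually (mem_principal_self (Set.Ici 3)))] with q hn
    exact (h q.1 q.2 hn).nullMeasurableSet_nonconst
  exact tendsto_measureReal_sub_of_cond hmeas hD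
    ((tendsto_cond_real_maxCorr_sub_limitDF h hY x).mono_left hl)

lemma tendsto_measureReal_nonconst_of_ae
    (hD : ∀ p n, 3 ≤ n → ∀ᵐ ω ∂(μ p n), ω ∈ nonconst (Y p n)) :
    Tendsto (fun q : ℕ × ℕ => (μ q.1 q.2).real (nonconst (Y q.1 q.2)))
      (atTop ×ˢ 𝓟 (Set.Ici 3)) (𝓝 1) := by
  refine tendsto_const_nhds.congr' ?_
  filter_upwards [tendsto_snd.eventually (mem_principal_self (Set.Ici 3))] with q hn
  have huniv : nonconst (Y q.1 q.2) =ᵐ[μ q.1 q.2] Set.univ := eventuallyEq_univ.2 (hD q.1 q.2 hn)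
  rw [measureReal_congr huniv, probReal_univ]

end Normalized

theorem theorem3_general :
    (∀ (Ω : ℕ → ℕ → Type u) [∀ p n, MeasurableSpace (Ω p n)]
      (μ : ∀ p n, Measure (Ω p n)) [∀ p n, IsProbabilityMeasure (μ p n)]
      (L : ∀ p n, Fin p → Ω p n → EuclideanSpace ℝ (Fin n))
      (U : ∀ p n, Ω p n → EuclideanSpace ℝ (Fin n)),
      (∀ p n, 2 ≤ n → IsSphereSample (L p n) (U p n) (μ p n)) →
      ∀ x : ℝ,
        Tendsto (fun p : ℕ => ⨆ n : {n : ℕ // 2 ≤ n},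
          |(μ p n).real {ω | (maxInner (L p n) (U p n) ω ^ 2 - aConst p n) / bConst p n < x}
            - limitDF n x|) atTop (𝓝 0) ∧
        Tendsto (fun q : ℕ × ℕ => (μ q.1 q.2).real
          {ω | (maxInner (L q.1 q.2) (U q.1 q.2) ω ^ 2 - aConst q.1 q.2) / bConst q.1 q.2 < x})
          (atTop ×ˢ atTop) (𝓝 (Real.exp (-Real.exp (-x))))) ∧
    (∀ (Ω : ℕ → ℕ → Type u) [∀ p n, MeasurableSpace (Ω p n)]
      (μ : ∀ p n, Measure (Ω p n)) [∀ p n, IsProbabilityMeasure (μ p n)]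
      (X : ∀ p n, Fin n → Fin p → Ω p n → ℝ) (Y : ∀ p n, Fin n → Ω p n → ℝ),
      (∀ p n, 3 ≤ n → IsGaussianDesign (X p n) (Y p n) (μ p n)) →
      (∀ p n, 3 ≤ n → μ p n (nonconst (Y p n)) ≠ 0) →
      ∀ x : ℝ,
        Tendsto (fun p : ℕ => ⨆ n : {n : ℕ // 3 ≤ n},
          |(cond (μ p n) (nonconst (Y p n))).real
              {ω | (maxCorr (X p n) (Y p n) ω ^ 2 - aConst p (n - 1)) / bConst p (n - 1) < x}
            - limitDF (n - 1) x|) atTop (𝓝 0) ∧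
        Tendsto (fun q : ℕ × ℕ => (cond (μ q.1 q.2) (nonconst (Y q.1 q.2))).real
          {ω | (maxCorr (X q.1 q.2) (Y q.1 q.2) ω ^ 2 - aConst q.1 (q.2 - 1))
            / bConst q.1 (q.2 - 1) < x})
          (atTop ×ˢ atTop) (𝓝 (Real.exp (-Real.exp (-x)))) ∧
        ((∀ p n, 3 ≤ n → ∀ᵐ ω ∂(μ p n), ω ∈ nonconst (Y p n)) →
          Tendsto (fun p : ℕ => ⨆ n : {n : ℕ // 3 ≤ n},
            |(μ p n).real
                {ω | (maxCorr (X p n) (Y p n) ω ^ 2 - aConst p (n - 1)) / bConst p (n - 1) < x}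
              - limitDF (n - 1) x|) atTop (𝓝 0)) ∧
        (Tendsto (fun q : ℕ × ℕ => (μ q.1 q.2).real (nonconst (Y q.1 q.2)))
            (atTop ×ˢ atTop) (𝓝 1) →
          Tendsto (fun q : ℕ × ℕ => (μ q.1 q.2).real
            {ω | (maxCorr (X q.1 q.2) (Y q.1 q.2) ω ^ 2 - aConst q.1 (q.2 - 1))
              / bConst q.1 (q.2 - 1) < x})
            (atTop ×ˢ atTop) (𝓝 (Real.exp (-Real.exp (-x)))))) := by
  have hle (k : ℕ) := atTop_prod_atTop_le_prod_principal (atTop : Filter ℕ) k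
  have hpred (x : ℝ) := (tendsto_limitDF x).comp (tendsto_sub_atTop_nat 1)
  refine ⟨fun Ω _ μ _ L U h x => ?_, fun Ω _ μ _ X Y h hY x => ?_⟩
  · have hinner := tendsto_measureReal_maxInner_sub_limitDF h x
    exact ⟨(tendsto_iSup_abs_of_prod_principal hinner :),
      tendsto_of_tendsto_sub_comp_snd (hinner.mono_left (hle 2)) (tendsto_limitDF x)⟩
  · have hcond := tendsto_cond_real_maxCorr_sub_limitDF h hY x
    refine ⟨(tendsto_iSup_abs_of_prod_principal hcond :),
      tendsto_of_tendsto_sub_comp_snd (hcond.mono_left (hle 3)) (hpred x), fun hae => ?_,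
      fun hprob => ?_⟩
    · exact (tendsto_iSup_abs_of_prod_principal (tendsto_measureReal_maxCorr_sub_limitDF h hY x
        le_rfl (tendsto_measureReal_nonconst_of_ae hae)) :)
    · exact tendsto_of_tendsto_sub_comp_snd
        (tendsto_measureReal_maxCorr_sub_limitDF h hY x (hle 3) hprob) (hpred x)

theorem theorem3 :
    -- Part 1: the maximal independent inner product
    (∀ (Ω : ℕ → ℕ → Type u) [∀ p n, MeasurableSpace (Ω p n)]
      (μ : ∀ p n, Measure (Ω p n)) [∀ p n, IsProbabilityMeasure (μ p n)]
      (L : ∀ p n, Fin p → Ω p n → EuclideanSpace ℝ (Fin n))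
      (U : ∀ p n, Ω p n → EuclideanSpace ℝ (Fin n)),
      (∀ p n, 2 ≤ n → IsSphereSample (L p n) (U p n) (μ p n)) →
      ∀ x : ℝ,
        Tendsto (fun p : ℕ => ⨆ n : {n : ℕ // 2 ≤ n},
          |(μ p n).real {ω | (maxInner (L p n) (U p n) ω ^ 2 - aConst p n) / bConst p n < x}
            - limitDF n x|) atTop (𝓝 0) ∧
        Tendsto (fun q : ℕ × ℕ => (μ q.1 q.2).real
          {ω | (maxInner (L q.1 q.2) (U q.1 q.2) ω ^ 2 - aConst q.1 q.2) / bConst q.1 q.2 < x})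
          (atTop ×ˢ atTop) (𝓝 (Real.exp (-Real.exp (-x))))) ∧
    -- Part 2: the maximal spurious correlation
    (∀ (Ω : ℕ → ℕ → Type u) [∀ p n, MeasurableSpace (Ω p n)]
      (μ : ∀ p n, Measure (Ω p n)) [∀ p n, IsProbabilityMeasure (μ p n)]
      (X : ∀ p n, Fin n → Fin p → Ω p n → ℝ) (Y : ∀ p n, Fin n → Ω p n → ℝ),
      (∀ p n, 3 ≤ n → IsGaussianSample (X p n) (Y p n) (μ p n)) →
      (∀ p n, 3 ≤ n → μ p n (nonconst (Y p n)) ≠ 0) →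
      ∀ x : ℝ,
        -- conditionally on the sample correlations being defined, for every nondegenerate `Y`
        Tendsto (fun p : ℕ => ⨆ n : {n : ℕ // 3 ≤ n},
          |(cond (μ p n) (nonconst (Y p n))).real
              {ω | (maxCorr (X p n) (Y p n) ω ^ 2 - aConst p (n - 1)) / bConst p (n - 1) < x}
            - limitDF (n - 1) x|) atTop (𝓝 0) ∧
        Tendsto (fun q : ℕ × ℕ => (cond (μ q.1 q.2) (nonconst (Y q.1 q.2))).real
          {ω | (maxCorr (X q.1 q.2) (Y q.1 q.2) ω ^ 2 - aConst q.1 (q.2 - 1))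
            / bConst q.1 (q.2 - 1) < x})
          (atTop ×ˢ atTop) (𝓝 (Real.exp (-Real.exp (-x)))) ∧
        -- unconditionally, uniformly in `n`, if they are almost surely defined
        ((∀ p n, 3 ≤ n → ∀ᵐ ω ∂(μ p n), ω ∈ nonconst (Y p n)) →
          Tendsto (fun p : ℕ => ⨆ n : {n : ℕ // 3 ≤ n},
            |(μ p n).real
                {ω | (maxCorr (X p n) (Y p n) ω ^ 2 - aConst p (n - 1)) / bConst p (n - 1) < x}
              - limitDF (n - 1) x|) atTop (𝓝 0)) ∧
        -- unconditionally, as `n, p → ∞`, if they are defined with probability tending to one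
        (Tendsto (fun q : ℕ × ℕ => (μ q.1 q.2).real (nonconst (Y q.1 q.2)))
            (atTop ×ˢ atTop) (𝓝 1) →
          Tendsto (fun q : ℕ × ℕ => (μ q.1 q.2).real
            {ω | (maxCorr (X q.1 q.2) (Y q.1 q.2) ω ^ 2 - aConst q.1 (q.2 - 1))
              / bConst q.1 (q.2 - 1) < x})
            (atTop ×ˢ atTop) (𝓝 (Real.exp (-Real.exp (-x)))))) := by
  exact ⟨theorem3_general.1, fun Ω _ μ _ X Y h =>
    theorem3_general.2 Ω μ X Y fun p n hn => (h p n hn).isGaussianDesign⟩
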